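/- Let $\Gamma$ be a finite acyclic perfect cylindrical network with $N$ sources and $N$ sinks, that is, a finite directed graph without directed cycles, embedded in an oriented cylinder, with univalent boundary vertices, all $N$ sources on one boundary circle and all $N$ sinks on the other one, and with trivalent internal vertices, each having at least one incoming and at least one outgoing edge. (An internal vertex is white if it has exactly one incoming edge and black if it has exactly one outgoing edge.) Fix a cut: an oriented curve from the source circle to the sink circle, avoiding the vertices and transversal to the edges. Draw the cylinder cut open along the cut as a rectangle, with sources on the left edge, sinks on the right edge, the cut being the top and bottom edges oriented from left to right; number the sources and the sinks $1,\dots,N$ from top to bottom. Let $\mathbf k=\mathbb C(\lambda,\mu)$. Glue the boundary circles, identifying the $i$-th sink with the $i$-th source, to get a network on a torus with $N$ marked points, and let $\mathcal C$ be the $\mathbf k$-linear category whose objects are the marked points and whose morphisms are the $\mathbf k$-linear combinations of directed paths between marked points in the torus network, $fg$ being "first $f$, then $g$". The boundary measurement matrix $B(\lambda)\in\mathrm{Mat}_N(\mathcal C)$ has the entries $B(\lambda)_{ij}=\sum_{p:i\to j}\lambda^{d(p)}\,p$, the sum being over the directed paths $p$ in $\Gamma$ from source $i$ to sink $j$, and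 $d(p)\in\mathbb Z$ being the oriented intersection index of $p$ with the cut (a crossing from the right side of the cut to its left side counts $+1$, the opposite one $-1$). Let $\{\!\{-,-\}\!\}:\mathrm{Hom}(a,b)\otimes\mathrm{Hom}(c,d)\to\mathrm{Hom}(c,b)\otimes\mathrm{Hom}(a,d)$ be the double bracket on paths of the torus network determined by skew-symmetry $\{\!\{f,g\}\!\}=-\{\!\{g,f\}\!\}^\tau$, the Leibniz identities $\{\!\{fg,h\}\!\}=(1\otimes f)\{\!\{g,h\}\!\}+\{\!\{f,h\}\!\}(g\otimes1)$, $\{\!\{f,gh\}\!\}=(g\otimes1)\{\!\{f,h\}\!\}+\{\!\{f,g\}\!\}(1\otimes h)$, and its values on edges, which are sums of the following contributions of internal vertices: $\{\!\{x_1,x_2\}\!\}=\tfrac12\,x_1\otimes x_2$ at a white vertex whose edges in counterclockwise order are $x_1,x_2,x_3$ with $x_3$ incoming; $\{\!\{y_1,y_2\}\!\}=-\tfrac12\,y_2\otimes y_1$ at a black vertex whose edges in counterclockwise order are $y_1,y_2,y_3$ with $y_3$ outgoing; all other contributions vanish. It restricts to $\mathcal C$. Let $\mathcal C_\natural=\bigl(\bigoplus_X\mathrm{Hom}_{\mathcal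 C}(X,X)\bigr)/[\mathcal C,\mathcal C]$, write $\overline f$ for the class of $f$, and let $\{-,-\}:\mathcal C_\natural\otimes\mathcal C\to\mathcal C$ be the induced $H_0$-Poisson bracket: $\{\overline f,g\}$ is obtained from $\{\!\{f,g\}\!\}$ by concatenating the two tensor factors. Let $\rho_{ab}(\lambda,\mu)$ be the coefficients of the trigonometric $r$-matrix $$r(\lambda,\mu)=\frac12\,\frac{\mu+\lambda}{\mu-\lambda}\sum_{a}E_{aa}\boxtimes E_{aa}+\frac1{\mu-\lambda}\sum_{a<b}\bigl(\lambda\,E_{ab}\boxtimes E_{ba}+\mu\,E_{ba}\boxtimes E_{ab}\bigr)=\sum_{a,b=1}^N\rho_{ab}(\lambda,\mu)\,E_{ab}\boxtimes E_{ba}.$$ Then for every integer $k\ge 0$ the matrix $B$ satisfies, entry by entry, the Lax equation $$\bigl\{\overline{\operatorname{tr}B(\lambda)^k},\,B(\mu)\bigr\}=M(\lambda,\mu;k)\,B(\mu)-B(\mu)\,M(\lambda,\mu;k),\qquad M(\lambda,\mu;k)_{b_1b_2}=k\,\rho_{b_2b_1}(\lambda,\mu)\,\bigl(B(\lambda)^k\bigr)_{b_1b_2}.$$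 -/

import Mathlib

open scoped TensorProduct DirectSum

noncomputable section

namespace NCNetwork

universe u v w

/-! ## Linear path categories, matrices, cyclic spaces -/

section PathCategory

variable (K : Type w) [Field K] {Q : Type u} [Quiver.{v} Q]

/-- Morphisms `a ⟶ b` of the `K`-linear category generated by the quiver `Q`:
finite `K`-linear combinations of paths from `a` to `b`. -/
def Mor (a b : Q) : Type (max u v w) := Quiver.Path a b →₀ K

instance (a b : Q) : AddCommGroup (Mor K a b) := inferInstanceAs (AddCommGroup (_ →₀ K))

instance (a b : Q) : Module K (Mor K a b) := inferInstanceAs (Module K (_ →₀ K))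

/-- The basis morphism given by a path. -/
def ofPath {a b : Q} (p : Quiver.Path a b) : Mor K a b := Finsupp.single p 1

/-- Linear extension of a map defined on paths. -/
def Mor.lift {a b : Q} {X : Type*} [AddCommGroup X] [Module K X] (φ : Quiver.Path a b → X) :
    Mor K a b →ₗ[K] X :=
  Finsupp.linearCombination K φ

/-- Concatenation `Hom(a,b) × Hom(b,c) → Hom(a,c)`, written `f g` (first `f`, then `g`). -/
def concat (a b c : Q) : Mor K a b →ₗ[K] Mor K b c →ₗ[K] Mor K a c :=
  Mor.lift K fun p => Mor.lift K fun q => ofPath K (p.comp q)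

variable {K}

@[simp]
theorem Mor.lift_ofPath {a b : Q} {X : Type*} [AddCommGroup X] [Module K X]
    (φ : Quiver.Path a b → X) (p : Quiver.Path a b) : Mor.lift K φ (ofPath K p) = φ p :=
  (Finsupp.linearCombination_single K 1 p).trans (one_smul K _)

theorem Mor.hom_ext {a b : Q} {X : Type*} [AddCommGroup X] [Module K X]
    {φ ψ : Mor K a b →ₗ[K] X} (h : ∀ p, φ (ofPath K p) = ψ (ofPath K p)) : φ = ψ :=
  Finsupp.lhom_ext' fun p => LinearMap.ext_ring (h p)

theorem Mor.induction {a b : Q} {P : Mor K a b → Prop} (f : Mor K a b) (zero : P 0)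
    (add : ∀ f g, P f → P g → P (f + g)) (smul : ∀ (r : K) f, P f → P (r • f))
    (basis : ∀ p, P (ofPath K p)) : P f := by
  refine Finsupp.induction_linear (motive := P) f zero add fun p r => ?_
  have h := smul r _ (basis p)
  have e : r • ofPath K p = (Finsupp.single p r : Quiver.Path a b →₀ K) :=
    Finsupp.smul_single_one p r
  exact e ▸ h

@[simp]
theorem concat_ofPath {a b c : Q} (p : Quiver.Path a b) (q : Quiver.Path b c) :
    concat K a b c (ofPath K p) (ofPath K q) = ofPath K (p.comp q) := by
  simp [concat]

theorem concat_assoc {a b c d : Q} (f : Mor K a b) (g : Mor K b c) (h : Mor K c d) :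
    concat K a c d (concat K a b c f g) h = concat K a b d f (concat K b c d g h) := by
  induction f using Mor.induction with
  | zero => simp
  | add f₁ f₂ h₁ h₂ => simp [h₁, h₂]
  | smul r f hf => simp [hf]
  | basis p =>
    induction g using Mor.induction with
    | zero => simp
    | add f₁ f₂ h₁ h₂ => simp [h₁, h₂]
    | smul r f hf => simp [hf]
    | basis q =>
      induction h using Mor.induction with
      | zero => simp
      | add f₁ f₂ h₁ h₂ => simp only [map_add, h₁, h₂]
      | smul r f hf => simp only [map_smul, hf]
      | basis q' => simp

variable (K)

/-- `f ↦ (x ↦ f x)`. -/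
abbrev lmul {a b : Q} (c : Q) (f : Mor K a b) : Mor K b c →ₗ[K] Mor K a c := concat K a b c f

/-- `f ↦ (x ↦ x f)`. -/
abbrev rmul (a : Q) {b c : Q} (f : Mor K b c) : Mor K a b →ₗ[K] Mor K a c :=
  (concat K a b c).flip f

/-- Square matrices with `(i,j)` entry in `Hom(x i, x j)`: matrices over the full subcategory
on the objects `x i`. -/
abbrev PMat {ι : Type} (x : ι → Q) : Type (max u v w) := ∀ i j, Mor K (x i) (x j)

variable {K}

/-- Matrix product: `(A B)_{il} = ∑_j A_{ij} B_{jl}`. -/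
def PMat.mul {ι : Type} [Fintype ι] {x : ι → Q} (A B : PMat K x) : PMat K x :=
  fun i l => ∑ j, concat K (x i) (x j) (x l) (A i j) (B j l)

variable (K) in
/-- The identity matrix. -/
def PMat.one {ι : Type} [DecidableEq ι] (x : ι → Q) : PMat K x := fun i j =>
  if h : i = j then ofPath K (Quiver.Path.nil.cast rfl (congrArg x h)) else 0

/-- Powers of a square matrix. -/
def PMat.pow {ι : Type} [Fintype ι] [DecidableEq ι] {x : ι → Q} (A : PMat K x) : ℕ → PMat K x
  | 0 => PMat.one K x
  | k + 1 => PMat.mul (PMat.pow A k) A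

/-- Span of the commutators `f g - g f`, for `f : x i ⟶ x j` and `g : x j ⟶ x i`. -/
def commutators (K : Type w) [Field K] {ι : Type} [DecidableEq ι] (x : ι → Q) :
    Submodule K (⨁ i, Mor K (x i) (x i)) :=
  Submodule.span K {z | ∃ (i j : ι) (f : Mor K (x i) (x j)) (g : Mor K (x j) (x i)),
    z = DirectSum.lof K ι (fun i => Mor K (x i) (x i)) i (concat K _ _ _ f g) -
      DirectSum.lof K ι (fun i => Mor K (x i) (x i)) j (concat K _ _ _ g f)}

/-- The cyclic space `C_♮ = (⨁_X Hom(X,X)) / [C,C]` of the full subcategory `C` on the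
objects `x i`. -/
abbrev CyclicSpace (K : Type w) [Field K] {ι : Type} [DecidableEq ι] (x : ι → Q) :=
  (⨁ i, Mor K (x i) (x i)) ⧸ commutators K x

/-- The class in the cyclic space of the trace of a square matrix. -/
def PMat.cyclicTrace {ι : Type} [Fintype ι] [DecidableEq ι] {x : ι → Q} (A : PMat K x) :
    CyclicSpace K x :=
  (commutators K x).mkQ (∑ i, DirectSum.lof K ι (fun i => Mor K (x i) (x i)) i (A i i))

end PathCategory

/-! ## Double brackets and the induced `H₀`-Poisson bracket -/

section DoubleBrackets

variable (K : Type w) [Field K] (Q : Type u) [Quiver.{v} Q]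

/-- A double bracket on the `K`-linear path category of `Q`: a family of maps
`Hom(a,b) ⊗ Hom(c,d) → Hom(c,b) ⊗ Hom(a,d)`, skew-symmetric and satisfying the double
Leibniz identities
`{{fg,h}} = (1 ⊗ f){{g,h}} + {{f,h}}(g ⊗ 1)` and `{{f,gh}} = (g ⊗ 1){{f,h}} + {{f,g}}(1 ⊗ h)`. -/
structure DoubleBracket where
  br : ∀ a b c d : Q, Mor K a b →ₗ[K] Mor K c d →ₗ[K] Mor K c b ⊗[K] Mor K a d
  skew : ∀ {a b c d : Q} (f : Mor K a b) (g : Mor K c d),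
    br a b c d f g = -TensorProduct.comm K (Mor K a d) (Mor K c b) (br c d a b g f)
  leibniz_left : ∀ {a b c p q : Q} (f : Mor K a b) (g : Mor K b c) (h : Mor K p q),
    br a c p q (concat K a b c f g) h =
      TensorProduct.map LinearMap.id (lmul K q f) (br b c p q g h) +
      TensorProduct.map (rmul K p g) LinearMap.id (br a b p q f h)
  leibniz_right : ∀ {p q a b c : Q} (f : Mor K p q) (g : Mor K a b) (h : Mor K b c),
    br p q a c f (concat K a b c g h) =
      TensorProduct.map (lmul K q g) LinearMap.id (br p q b c f h) +
      TensorProduct.map LinearMap.id (rmul K p h) (br p q a b f g)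

variable {K Q}

/-- `{f, g} = μ({{f, g}})` for a loop `f` and a morphism `g`. -/
def DoubleBracket.loopBracket (D : DoubleBracket K Q) (a c d : Q) :
    Mor K a a →ₗ[K] Mor K c d →ₗ[K] Mor K c d :=
  (D.br a a c d).compr₂ (TensorProduct.lift (concat K c a d))

theorem DoubleBracket.loopBracket_comm (D : DoubleBracket K Q) {a b : Q} (c d : Q)
    (f : Mor K a b) (g : Mor K b a) (h : Mor K c d) :
    D.loopBracket a c d (concat K a b a f g) h = D.loopBracket b c d (concat K b a b g f) h := by
  have key : ∀ {a b : Q} (f : Mor K a b) (t : Mor K c a ⊗[K] Mor K b d),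
      TensorProduct.lift (concat K c a d) (TensorProduct.map LinearMap.id (lmul K d f) t) =
        TensorProduct.lift (concat K c b d) (TensorProduct.map (rmul K c f) LinearMap.id t) := by
    intro a b f t
    induction t using TensorProduct.induction_on with
    | zero => simp
    | tmul u v => simp [concat_assoc]
    | add s t hs ht => simp only [map_add, hs, ht]
  simp only [loopBracket, LinearMap.compr₂_apply, D.leibniz_left, map_add]
  rw [key, key, add_comm]

/-- The `H₀`-Poisson bracket `{-,-} : C_♮ ⊗ C → C` induced by a double bracket, where `C` is the
full subcategory on the objects `x i`: it sends the class of a loop `f` and a morphism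
`g : x c ⟶ x d` to the concatenation of the two tensor factors of `{{f, g}}`. -/
def DoubleBracket.hBracket (D : DoubleBracket K Q) {ι : Type} [DecidableEq ι] (x : ι → Q)
    (c d : ι) : CyclicSpace K x →ₗ[K] Mor K (x c) (x d) →ₗ[K] Mor K (x c) (x d) :=
  (commutators K x).liftQ
    (DirectSum.toModule K ι _ fun i => D.loopBracket (x i) (x c) (x d)) (by
      rw [commutators, Submodule.span_le]
      rintro z ⟨i, j, f, g, rfl⟩
      simp only [SetLike.mem_coe, LinearMap.mem_ker, map_sub, DirectSum.toModule_lof]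
      rw [sub_eq_zero]
      exact LinearMap.ext fun t => D.loopBracket_comm (x c) (x d) f g t)

/-! ### The double bracket with prescribed values on arrows -/

/-- Values of a prospective double bracket on pairs of arrows. -/
abbrev ArrowBracket (K : Type w) [Field K] (Q : Type u) [Quiver.{v} Q] :=
  ∀ ⦃a b c d : Q⦄, (a ⟶ b) → (c ⟶ d) → Mor K c b ⊗[K] Mor K a d

/-- Extension to (arrow, path) by the second Leibniz identity. -/
def arrowPathBr (eb : ArrowBracket K Q) {a b : Q} (e : a ⟶ b) {c : Q} :
    ∀ {d : Q}, Quiver.Path c d → Mor K c b ⊗[K] Mor K a d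
  | _, Quiver.Path.nil => 0
  | _, Quiver.Path.cons g h =>
      TensorProduct.map (lmul K b (ofPath K g)) LinearMap.id (eb e h) +
      TensorProduct.map LinearMap.id (rmul K a (ofPath K h.toPath)) (arrowPathBr eb e g)

/-- Extension to pairs of paths by the first Leibniz identity. -/
def pathBr (eb : ArrowBracket K Q) {a c d : Q} :
    ∀ {b : Q}, Quiver.Path a b → Quiver.Path c d → Mor K c b ⊗[K] Mor K a d
  | _, Quiver.Path.nil, _ => 0
  | _, Quiver.Path.cons f e, g =>
      TensorProduct.map LinearMap.id (lmul K d (ofPath K f)) (arrowPathBr eb e g) +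
      TensorProduct.map (rmul K c (ofPath K e.toPath)) LinearMap.id (pathBr eb f g)

/-- Bilinear extension of `pathBr`. -/
def linBr (eb : ArrowBracket K Q) (a b c d : Q) :
    Mor K a b →ₗ[K] Mor K c d →ₗ[K] Mor K c b ⊗[K] Mor K a d :=
  Mor.lift K fun p => Mor.lift K fun q => pathBr eb p q

theorem lmul_nil {a b : Q} : lmul K b (ofPath K (Quiver.Path.nil : Quiver.Path a a)) =
    LinearMap.id := by
  refine Mor.hom_ext fun p => ?_; simp

theorem rmul_nil {a b : Q} : rmul K b (ofPath K (Quiver.Path.nil : Quiver.Path a a)) =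
    LinearMap.id := by
  refine Mor.hom_ext fun p => ?_; simp

theorem lmul_comp {a b c d : Q} (p : Quiver.Path a b) (q : Quiver.Path b c) :
    lmul K d (ofPath K (p.comp q)) = lmul K d (ofPath K p) ∘ₗ lmul K d (ofPath K q) := by
  refine Mor.hom_ext fun r => ?_; simp

theorem rmul_comp {a b c d : Q} (p : Quiver.Path a b) (q : Quiver.Path b c) :
    rmul K d (ofPath K (p.comp q)) = rmul K d (ofPath K q) ∘ₗ rmul K d (ofPath K p) := by
  refine Mor.hom_ext fun r => ?_; simp

theorem lmul_rmul {a b c d : Q} (p : Quiver.Path a b) (q : Quiver.Path c d) :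
    lmul K d (ofPath K p) ∘ₗ rmul K b (ofPath K q) =
      rmul K a (ofPath K q) ∘ₗ lmul K c (ofPath K p) := by
  refine Mor.hom_ext fun r => ?_; simp

theorem arrowPathBr_comp (eb : ArrowBracket K Q) {a b : Q} (e : a ⟶ b) {c p d : Q}
    (g : Quiver.Path c p) (h : Quiver.Path p d) :
    arrowPathBr eb e (g.comp h) =
      TensorProduct.map (lmul K b (ofPath K g)) LinearMap.id (arrowPathBr eb e h) +
      TensorProduct.map LinearMap.id (rmul K a (ofPath K h)) (arrowPathBr eb e g) := by
  induction h with
  | nil => simp [arrowPathBr, rmul_nil]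
  | cons h k ih =>
    rw [Quiver.Path.comp_cons, arrowPathBr, arrowPathBr, ih, lmul_comp,
      show h.cons k = h.comp k.toPath from rfl, rmul_comp]
    simp only [map_add, ← LinearMap.comp_apply, ← TensorProduct.map_comp, LinearMap.id_comp,
      LinearMap.comp_id]
    abel

theorem pathBr_comp_left (eb : ArrowBracket K Q) {a b c p d : Q} (f : Quiver.Path a b)
    (g : Quiver.Path b c) (h : Quiver.Path p d) :
    pathBr eb (f.comp g) h =
      TensorProduct.map LinearMap.id (lmul K d (ofPath K f)) (pathBr eb g h) +
      TensorProduct.map (rmul K p (ofPath K g)) LinearMap.id (pathBr eb f h) := by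
  induction g with
  | nil => simp [pathBr, rmul_nil]
  | cons g k ih =>
    rw [Quiver.Path.comp_cons, pathBr, pathBr, ih, lmul_comp,
      show g.cons k = g.comp k.toPath from rfl, rmul_comp]
    simp only [map_add, ← LinearMap.comp_apply, ← TensorProduct.map_comp, LinearMap.id_comp,
      LinearMap.comp_id]
    abel

theorem pathBr_comp_right (eb : ArrowBracket K Q) {p q a b c : Q} (f : Quiver.Path p q)
    (g : Quiver.Path a b) (h : Quiver.Path b c) :
    pathBr eb f (g.comp h) =
      TensorProduct.map (lmul K q (ofPath K g)) LinearMap.id (pathBr eb f h) +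
      TensorProduct.map LinearMap.id (rmul K p (ofPath K h)) (pathBr eb f g) := by
  induction f with
  | nil => simp [pathBr]
  | cons f k ih =>
    rw [pathBr, pathBr, pathBr, ih, arrowPathBr_comp]
    simp only [map_add, ← LinearMap.comp_apply, ← TensorProduct.map_comp, LinearMap.id_comp,
      LinearMap.comp_id, lmul_rmul]
    abel

theorem pathBr_toPath (eb : ArrowBracket K Q) {a b c d : Q} (e : a ⟶ b) (g : Quiver.Path c d) :
    pathBr eb e.toPath g = arrowPathBr eb e g := by
  rw [Quiver.Hom.toPath, pathBr, pathBr, lmul_nil]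
  simp

theorem map_comm' {A B C D : Q} {A' B' C' D' : Q} (f : Mor K A B →ₗ[K] Mor K A' B')
    (g : Mor K C D →ₗ[K] Mor K C' D') (t : Mor K C D ⊗[K] Mor K A B) :
    TensorProduct.comm K _ _ (TensorProduct.map g f t) =
      TensorProduct.map f g (TensorProduct.comm K _ _ t) := by
  induction t using TensorProduct.induction_on with
  | zero => simp
  | tmul u v => simp
  | add s t hs ht => simp only [map_add, hs, ht]

theorem arrowPathBr_skew (eb : ArrowBracket K Q)
    (hs : ∀ ⦃a b c d : Q⦄ (e : a ⟶ b) (h : c ⟶ d),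
      eb e h = -TensorProduct.comm K (Mor K a d) (Mor K c b) (eb h e))
    {a b c d : Q} (e : a ⟶ b) (g : Quiver.Path c d) :
    arrowPathBr eb e g =
      -TensorProduct.comm K (Mor K a d) (Mor K c b) (pathBr eb g e.toPath) := by
  induction g with
  | nil => simp [arrowPathBr, pathBr]
  | cons g h ih =>
    rw [arrowPathBr, pathBr, map_add, map_comm', map_comm', ih, hs]
    have : arrowPathBr eb h e.toPath = eb h e := by
      rw [Quiver.Hom.toPath, arrowPathBr, arrowPathBr, lmul_nil]
      simp
    rw [this]
    simp only [map_neg]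
    abel

theorem pathBr_skew (eb : ArrowBracket K Q)
    (hs : ∀ ⦃a b c d : Q⦄ (e : a ⟶ b) (h : c ⟶ d),
      eb e h = -TensorProduct.comm K (Mor K a d) (Mor K c b) (eb h e))
    {a b c d : Q} (f : Quiver.Path a b) (g : Quiver.Path c d) :
    pathBr eb f g = -TensorProduct.comm K (Mor K a d) (Mor K c b) (pathBr eb g f) := by
  induction f with
  | nil =>
    have : pathBr eb g (Quiver.Path.nil : Quiver.Path a a) = 0 := by
      induction g with
      | nil => rfl
      | cons g h ih => rw [pathBr, ih, arrowPathBr]; simp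
    rw [this]; simp [pathBr]
  | cons f e ih =>
    rw [pathBr, show f.cons e = f.comp e.toPath from rfl, pathBr_comp_right, map_add, map_comm',
      map_comm', ih, arrowPathBr_skew eb hs]
    simp only [map_neg]
    abel

/-- The double bracket on the path category with prescribed (skew-symmetric) values on arrows. -/
def DoubleBracket.ofArrows (eb : ArrowBracket K Q)
    (hs : ∀ ⦃a b c d : Q⦄ (e : a ⟶ b) (h : c ⟶ d),
      eb e h = -TensorProduct.comm K (Mor K a d) (Mor K c b) (eb h e)) :
    DoubleBracket K Q where
  br := linBr eb
  skew {a b c d} f g := by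
    induction f using Mor.induction with
    | zero => simp
    | add f₁ f₂ h₁ h₂ => simp only [map_add, LinearMap.add_apply, h₁, h₂, neg_add]
    | smul r f hf => simp only [map_smul, LinearMap.smul_apply, hf, smul_neg]
    | basis p =>
      induction g using Mor.induction with
      | zero => simp
      | add f₁ f₂ h₁ h₂ => simp only [map_add, LinearMap.add_apply, h₁, h₂, neg_add]
      | smul r f hf => simp only [map_smul, LinearMap.smul_apply, hf, smul_neg]
      | basis q =>
        simp only [linBr, Mor.lift_ofPath]
        exact pathBr_skew eb hs p q
  leibniz_left {a b c p q} f g h := by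
    induction f using Mor.induction with
    | zero => simp
    | add f₁ f₂ h₁ h₂ =>
      simp only [map_add, LinearMap.add_apply, h₁, h₂, TensorProduct.map_add_right]; abel
    | smul r f hf =>
      simp only [map_smul, LinearMap.smul_apply, hf, TensorProduct.map_smul_right, smul_add]
    | basis x =>
      induction g using Mor.induction with
      | zero => simp
      | add f₁ f₂ h₁ h₂ =>
        simp only [map_add, LinearMap.add_apply, h₁, h₂, TensorProduct.map_add_left]; abel
      | smul r f hf =>
        simp only [map_smul, LinearMap.smul_apply, hf, TensorProduct.map_smul_left, smul_add]
      | basis y =>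
        induction h using Mor.induction with
        | zero => simp
        | add f₁ f₂ h₁ h₂ => simp only [map_add, h₁, h₂]; abel
        | smul r f hf => simp only [map_smul, hf, smul_add]
        | basis z =>
          simp only [concat_ofPath, linBr, Mor.lift_ofPath]
          exact pathBr_comp_left eb x y z
  leibniz_right {p q a b c} f g h := by
    induction f using Mor.induction with
    | zero => simp
    | add f₁ f₂ h₁ h₂ => simp only [map_add, LinearMap.add_apply, h₁, h₂]; abel
    | smul r f hf => simp only [map_smul, LinearMap.smul_apply, hf, smul_add]
    | basis x =>
      induction g using Mor.induction with
      | zero => simp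
      | add f₁ f₂ h₁ h₂ =>
        simp only [map_add, LinearMap.add_apply, h₁, h₂, TensorProduct.map_add_left]; abel
      | smul r f hf =>
        simp only [map_smul, LinearMap.smul_apply, hf, TensorProduct.map_smul_left, smul_add]
      | basis y =>
        induction h using Mor.induction with
        | zero => simp
        | add f₁ f₂ h₁ h₂ =>
          simp only [map_add, h₁, h₂, TensorProduct.map_add_right, LinearMap.add_apply]; abel
        | smul r f hf => simp only [map_smul, hf, TensorProduct.map_smul_right,
            LinearMap.smul_apply, smul_add]
        | basis z =>
          simp only [concat_ofPath, linBr, Mor.lift_ofPath]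
          exact pathBr_comp_right eb x y z

end DoubleBrackets

/-! ## Networks on the cylinder -/

/-- Vertices of a network with `m` sources on one boundary circle of the cylinder, `n` sinks on
the other one, and internal vertices `V`. -/
inductive CylVertex (V : Type u) (m n : ℕ) : Type u
  | source (i : Fin m) : CylVertex V m n
  | inner (v : V) : CylVertex V m n
  | sink (j : Fin n) : CylVertex V m n

/-- A directed multigraph with a rotation system. A dart (half-edge) is a pair `(e, s)`, where
`(e, false)` is the half of `e` at its tail and `(e, true)` the half at its head; `rot` sends a
dart to the next dart in the counterclockwise order at the same vertex, where each of the two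
boundary circles of the cylinder is regarded as one vertex. -/
structure RibbonNetwork (V : Type u) (E : Type v) (m n : ℕ) where
  src : E → CylVertex V m n
  tgt : E → CylVertex V m n
  rot : Equiv.Perm (E × Bool)

namespace RibbonNetwork

variable {V : Type u} {E : Type v} {m n : ℕ} (G : RibbonNetwork V E m n)

/-- The vertex of a dart. -/
def dartVertex : E × Bool → CylVertex V m n
  | (e, false) => G.src e
  | (e, true) => G.tgt e

/-- The other half of the same edge. -/
def flip (d : E × Bool) : E × Bool := (d.1, !d.2)

/-- The face permutation `d ↦ rot⁻¹ (flip d)`. Its cycles are the faces; the cycle of `d` is the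
face to the left of the edge when one leaves the vertex of `d` along `d`. -/
def facePerm : Equiv.Perm (E × Bool) where
  toFun d := G.rot.symm (flip d)
  invFun d := flip (G.rot d)
  left_inv d := by simp [flip]
  right_inv d := by simp [flip]

/-- `d` and `d'` have the same face on their left. -/
def SameFace (d d' : E × Bool) : Prop := G.facePerm.SameCycle d d'

/-- The number of faces. -/
def numFaces : ℕ := Nat.card (Quotient (Equiv.Perm.SameCycle.setoid G.facePerm))

/-- A curve transversal to the graph, avoiding its vertices, and running from the face to the left
of `d` to the face to the left of `d'`, given by the list of darts that it crosses: the letter `c`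
means that the curve passes from the face to the left of `c` to the face to the right of `c`. -/
def IsTransversalCurve : E × Bool → List (E × Bool) → E × Bool → Prop
  | d, [], d' => G.SameFace d d'
  | d, c :: l, d' => G.SameFace d c ∧ IsTransversalCurve (flip c) l d'

/-- The vertices of the network, as a quiver whose arrows are the directed edges. -/
def Pt (_ : RibbonNetwork V E m n) : Type u := CylVertex V m n

/-- The `i`-th source. -/
def sourcePt (i : Fin m) : G.Pt := CylVertex.source i

/-- The `j`-th sink. -/
def sinkPt (j : Fin n) : G.Pt := CylVertex.sink j

instance : Quiver.{v} G.Pt where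
  Hom a b := {e : E // G.src e = a ∧ G.tgt e = b}

end RibbonNetwork

/-- An acyclic perfect network on the cylinder with a chosen cut, with `m` sources on one boundary
circle and `n` sinks on the other. Collapsing the two boundary circles to points turns the
cylinder into a sphere, so the embedding is given by a rotation system of genus `0`, for
which the two boundary circles count as vertices. (Since there are no directed cycles, each
internal vertex is joined to both boundary circles, so the collapsed graph is connected.)

The cut runs from the source circle to the sink circle. After cutting, the
sources lie on the left edge and the sinks on the right edge of a rectangle, both numbered from
top to bottom, and the cut forms the top and the bottom edge. -/
structure PerfectCylindricalNetwork (V : Type u) (E : Type v) [Fintype V] [Fintype E] (m n : ℕ)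
    extends RibbonNetwork V E m n where
  /-- The unique edge at the `i`-th source. -/
  sourceEdge : Fin m → E
  /-- The unique edge at the `j`-th sink. -/
  sinkEdge : Fin n → E
  src_eq_source : ∀ e i, src e = .source i ↔ e = sourceEdge i
  tgt_ne_source : ∀ e i, tgt e ≠ .source i
  tgt_eq_sink : ∀ e j, tgt e = .sink j ↔ e = sinkEdge j
  src_ne_sink : ∀ e j, src e ≠ .sink j
  /-- Internal vertices are trivalent. -/
  trivalent : ∀ v, {d | toRibbonNetwork.dartVertex d = .inner v}.ncard = 3
  /-- Internal vertices are not sources. -/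
  exists_in : ∀ v, ∃ e, tgt e = .inner v
  /-- Internal vertices are not sinks. -/
  exists_out : ∀ v, ∃ e, src e = .inner v
  /-- The rotation permutes the darts at an internal vertex cyclically. -/
  rot_inner : ∀ v d d', toRibbonNetwork.dartVertex d = .inner v →
    (rot.SameCycle d d' ↔ toRibbonNetwork.dartVertex d' = .inner v)
  /-- Counterclockwise around the source circle, the sources are met from bottom to top. -/
  rot_source : ∀ i, rot (sourceEdge (finRotate m i), false) = (sourceEdge i, false)
  /-- Counterclockwise around the sink circle, the sinks are met from top to bottom. -/
  rot_sink : ∀ j, rot (sinkEdge j, true) = (sinkEdge (finRotate n j), true)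
  /-- The collapsed surface is a sphere: (vertices) - (edges) + (faces) = 2. -/
  euler : ((Fintype.card V + 2 : ℕ) : ℤ) - Fintype.card E + toRibbonNetwork.numFaces = 2
  /-- There are no directed cycles. -/
  acyclic : ∀ (a : toRibbonNetwork.Pt) (p : Quiver.Path a a), p = Quiver.Path.nil
  /-- The darts crossed by the cut, in order. -/
  cut : List (E × Bool)
  /-- The cut starts on the source circle, between the first and the last source and just above
  (to the left of) the first one, and ends on the sink circle, just above the first sink. -/
  isCut : ∀ (i : Fin m) (j : Fin n), i.val = 0 → j.val = 0 →
    toRibbonNetwork.IsTransversalCurve (sourceEdge i, false) cut (sinkEdge j, false)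

namespace PerfectCylindricalNetwork

variable {V : Type u} {E : Type v} [Fintype V] [Fintype E] {m n : ℕ}

/-! ### Paths and boundary measurements -/

section Paths

variable (G : PerfectCylindricalNetwork V E m n)

/-- The list of edges of a path, last edge first. -/
def edgeList {a : G.Pt} : ∀ {b : G.Pt}, Quiver.Path a b → List E
  | _, Quiver.Path.nil => []
  | _, Quiver.Path.cons p e => e.1 :: edgeList p

theorem edgeList_injective {a b : G.Pt} :
    Function.Injective (G.edgeList : Quiver.Path a b → List E) := by
  intro p q h
  induction p with
  | nil =>
    cases q with
    | nil => rfl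
    | cons q e => simp [edgeList] at h
  | cons p e ih =>
    cases q with
    | nil => simp [edgeList] at h
    | cons q e' =>
      obtain ⟨e, rfl, rfl⟩ := e
      obtain ⟨e', h1, h2⟩ := e'
      simp only [edgeList, List.cons.injEq] at h
      obtain ⟨rfl, h⟩ := h
      subst h1
      rw [ih h]

theorem exists_path_of_mem {a b : G.Pt} (p : Quiver.Path a b) (e : E) (he : e ∈ G.edgeList p) :
    Nonempty (Quiver.Path (V := G.Pt) (G.tgt e) b) := by
  induction p with
  | nil => simp [edgeList] at he
  | cons p f ih =>
    simp only [edgeList, List.mem_cons] at he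
    rcases he with rfl | he
    · obtain ⟨f, h1, rfl⟩ := f
      exact ⟨Quiver.Path.nil⟩
    · obtain ⟨q⟩ := ih he
      exact ⟨q.cons f⟩

theorem edgeList_nodup {a b : G.Pt} (p : Quiver.Path a b) : (G.edgeList p).Nodup := by
  induction p with
  | nil => simp [edgeList]
  | cons p e ih =>
    rw [edgeList, List.nodup_cons]
    refine ⟨fun he => ?_, ih⟩
    obtain ⟨q⟩ := G.exists_path_of_mem p e.1 he
    obtain ⟨e, h1, rfl⟩ := e
    have h := G.acyclic _ (q.cons ⟨e, h1, rfl⟩)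
    cases h

/-- Since the network is finite and acyclic, it has finitely many paths. -/
instance finite_path (a b : G.Pt) : Finite (Quiver.Path a b) := by
  have hf : Finite {l : List E // l.length ≤ Fintype.card E} :=
    (List.finite_length_le E (Fintype.card E)).to_subtype
  exact Finite.of_injective
    (fun p : Quiver.Path a b =>
      (⟨G.edgeList p, (G.edgeList_nodup p).length_le_card⟩ :
        {l : List E // l.length ≤ Fintype.card E}))
    fun p q h => G.edgeList_injective (congrArg Subtype.val h)

instance fintype_path (a b : G.Pt) : Fintype (Quiver.Path a b) := Fintype.ofFinite _

open Classical in
/-- The oriented intersection index of an edge with the cut: crossing the cut from its right to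
its left counts `+1`, from its left to its right `-1`. -/
def edgeIndex (e : E) : ℤ := (G.cut.count (e, false) : ℤ) - G.cut.count (e, true)

/-- The oriented intersection index of a path with the cut. -/
def pathIndex {a b : G.Pt} (p : Quiver.Path a b) : ℤ := ((G.edgeList p).map G.edgeIndex).sum

/-- The `(i,j)` entry `∑_{p : i → j} z^{ind p} wt(p)` of the boundary measurement matrix, in the
path category of the network. -/
def cylinderMeasurement (K : Type w) [Field K] (z : K) (i : Fin m) (j : Fin n) :
    Mor K (G.sourcePt i) (G.sinkPt j) :=
  ∑ p : Quiver.Path (G.sourcePt i) (G.sinkPt j), z ^ G.pathIndex p • ofPath K p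

end Paths

/-! ### The torus network -/

section Torus

variable {N : ℕ} (G : PerfectCylindricalNetwork V E N N)

/-- Vertices of the network on the torus obtained by gluing the two boundary circles: the `N`
marked points, where the `i`-th sink is glued to the `i`-th source, and the internal vertices. -/
def Torus (_ : PerfectCylindricalNetwork V E N N) : Type u := Fin N ⊕ V

/-- The gluing map on vertices. -/
def glue : CylVertex V N N → G.Torus
  | .source i => Sum.inl i
  | .inner v => Sum.inr v
  | .sink j => Sum.inl j

instance : Quiver.{v} G.Torus where
  Hom a b := {e : E // G.glue (G.src e) = a ∧ G.glue (G.tgt e) = b}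

/-- The gluing map from the network on the cylinder to the network on the torus. -/
def gluing : G.Pt ⥤q G.Torus where
  obj a := G.glue a
  map {_ _} e := ⟨e.1, congrArg G.glue e.2.1, congrArg G.glue e.2.2⟩

/-- The `i`-th marked point of the torus. The category `C` of the paths in the torus network
that start and end at marked points is the full subcategory on these objects. -/
def marked (i : Fin N) : G.Torus := Sum.inl i

/-- The path in the torus network given by a path from a source to a sink. -/
def gluePath {i j : Fin N} (p : Quiver.Path (G.sourcePt i) (G.sinkPt j)) :
    Quiver.Path (G.marked i) (G.marked j) := G.gluing.mapPath p

/-- The boundary measurement matrix `B(z)`, with entries in `C`. -/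
def boundaryMeasurement (K : Type w) [Field K] (z : K) : PMat K G.marked := fun i j =>
  Mor.lift K (fun p => ofPath K (G.gluePath p))
    (G.cylinderMeasurement K z i j)

/-! ### The double bracket -/

open Classical in
/-- `1/2` if `d'` is the successor of `d` at an internal vertex, `-1/2` if it is the predecessor,
and `0` otherwise. -/
def cornerCoeff (K : Type w) [Field K] (d d' : E × Bool) : K :=
  (if (∃ v, G.dartVertex d = .inner v) ∧ G.rot d = d' then 1 / 2 else 0) -
    (if (∃ v, G.dartVertex d' = .inner v) ∧ G.rot d' = d then 1 / 2 else 0)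

open Classical in
/-- The local double bracket, a sum of contributions of the internal vertices.
At a white vertex with darts `x₁, x₂, x₃` in counterclockwise order, `x₃` incoming, it is
`{{x₁, x₂}} = (1/2) x₁ ⊗ x₂`; at a black vertex with darts `y₁, y₂, y₃` in counterclockwise order,
`y₃` outgoing, it is `{{y₁, y₂}} = -(1/2) y₂ ⊗ y₁`; these are extended by skew-symmetry, and the
remaining brackets of edges vanish. -/
def edgeBracket (K : Type w) [Field K] : ArrowBracket K G.Torus := fun a b c d e h =>
  (if H : a = c then
    G.cornerCoeff K (e.1, false) (h.1, false) •
      (ofPath K (Quiver.Hom.toPath (⟨e.1, e.2.1.trans H, e.2.2⟩ : c ⟶ b)) ⊗ₜ[K]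
        ofPath K (Quiver.Hom.toPath (⟨h.1, h.2.1.trans H.symm, h.2.2⟩ : a ⟶ d)))
    else 0) -
  (if H : b = d then
    G.cornerCoeff K (e.1, true) (h.1, true) •
      (ofPath K (Quiver.Hom.toPath (⟨h.1, h.2.1, h.2.2.trans H.symm⟩ : c ⟶ b)) ⊗ₜ[K]
        ofPath K (Quiver.Hom.toPath (⟨e.1, e.2.1, e.2.2.trans H⟩ : a ⟶ d)))
    else 0)

theorem cornerCoeff_swap (K : Type w) [Field K] (d d' : E × Bool) :
    G.cornerCoeff K d d' = -G.cornerCoeff K d' d := by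
  simp [cornerCoeff]

theorem edgeBracket_skew (K : Type w) [Field K] ⦃a b c d : G.Torus⦄ (e : a ⟶ b) (h : c ⟶ d) :
    G.edgeBracket K e h =
      -TensorProduct.comm K (Mor K a d) (Mor K c b) (G.edgeBracket K h e) := by
  unfold edgeBracket
  rw [G.cornerCoeff_swap K (e.1, false), G.cornerCoeff_swap K (e.1, true)]
  by_cases h1 : a = c
  · by_cases h2 : b = d
    · simp [h1, h2, neg_add_eq_sub]
    · simp [h1, h2, Ne.symm h2]
  · by_cases h2 : b = d
    · simp [h1, h2, Ne.symm h1]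
    · simp [h1, h2, Ne.symm h1, Ne.symm h2]

/-- The double bracket of the torus network (and hence of its full subcategory `C`). -/
def doubleBracket (K : Type w) [Field K] : DoubleBracket K G.Torus :=
  DoubleBracket.ofArrows (G.edgeBracket K) (G.edgeBracket_skew K)

/-- The induced `H₀`-Poisson bracket `C_♮ ⊗ C → C`. -/
def hBracket (K : Type w) [Field K] (i j : Fin N) : CyclicSpace K G.marked →ₗ[K]
    Mor K (G.marked i) (G.marked j) →ₗ[K] Mor K (G.marked i) (G.marked j) :=
  (G.doubleBracket K).hBracket G.marked i j

end Torus

end PerfectCylindricalNetwork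

/-! ## The trigonometric `r`-matrix -/

/-- The field `ℂ(λ, μ)` of rational functions in the spectral parameters. -/
abbrev SpectralField : Type := FractionRing (MvPolynomial (Fin 2) ℂ)

/-- The spectral parameter `λ`. -/
def specLam : SpectralField := algebraMap (MvPolynomial (Fin 2) ℂ) SpectralField (MvPolynomial.X 0)

/-- The spectral parameter `μ`. -/
def specMu : SpectralField := algebraMap (MvPolynomial (Fin 2) ℂ) SpectralField (MvPolynomial.X 1)

/-- The trigonometric `r`-matrix
`(1/2) (y+x)/(y-x) ∑_a E_aa ⊠ E_aa + 1/(y-x) ∑_{a<b} (x E_ab ⊠ E_ba + y E_ba ⊠ E_ab)`. -/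
def trigRMatrix {K : Type w} [Field K] (N : ℕ) (x y : K) :
    Matrix (Fin N × Fin N) (Fin N × Fin N) K :=
  (1 / 2 * ((y + x) / (y - x))) •
      ∑ a : Fin N, Matrix.kronecker (Matrix.single a a 1) (Matrix.single a a 1) +
    (1 / (y - x)) • ∑ a : Fin N, ∑ b ∈ Finset.Ioi a,
      (x • Matrix.kronecker (Matrix.single a b 1) (Matrix.single b a 1) +
        y • Matrix.kronecker (Matrix.single b a 1) (Matrix.single a b 1))

/-- The coefficient `ρ_{ab}(x,y)` of `E_ab ⊠ E_ba` in the trigonometric `r`-matrix. -/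
def trigRho {K : Type w} [Field K] (N : ℕ) (x y : K) (a b : Fin N) : K :=
  trigRMatrix N x y (a, b) (b, a)

theorem trigRho_eq {K : Type w} [Field K] (N : ℕ) (x y : K) (a b : Fin N) :
    trigRho N x y a b =
      if a = b then 1 / 2 * ((y + x) / (y - x))
      else if a < b then x / (y - x) else y / (y - x) := by
  have h1 : ∀ c : Fin N, Matrix.kronecker (Matrix.single c c (1 : K)) (Matrix.single c c 1)
      (a, b) (b, a) = if c = a ∧ c = b then 1 else 0 := by
    intro c
    by_cases hc : c = a <;> by_cases hd : c = b <;> simp [Matrix.kronecker, Matrix.single, hc, hd]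
  have h2 : ∀ c d : Fin N, Matrix.kronecker (Matrix.single c d (1 : K)) (Matrix.single d c 1)
      (a, b) (b, a) = if c = a ∧ d = b then 1 else 0 := by
    intro c d
    by_cases hc : c = a <;> by_cases hd : d = b <;> simp [Matrix.kronecker, Matrix.single, hc, hd]
  simp only [trigRho, trigRMatrix, Matrix.add_apply, Matrix.smul_apply, Matrix.sum_apply, h1, h2,
    smul_eq_mul]
  have h3 : ∀ u v : Fin N, ∑ c : Fin N, ∑ d ∈ Finset.Ioi c, (if c = u ∧ d = v then (1 : K) else 0)
      = if u < v then 1 else 0 := by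
    intro u v
    rw [Finset.sum_eq_single u (fun c _ hc => by simp [hc]) (by simp)]
    simp
  have h4 : ∑ c : Fin N, ∑ d ∈ Finset.Ioi c, (if d = a ∧ c = b then (1 : K) else 0)
      = if b < a then 1 else 0 := by
    rw [← h3 b a]
    exact Finset.sum_congr rfl fun c _ => Finset.sum_congr rfl fun d _ => by simp only [and_comm]
  have h5 : ∑ c : Fin N, (if c = a ∧ c = b then (1 : K) else 0) = if a = b then 1 else 0 := by
    rw [Finset.sum_eq_single a (fun c _ hc => by simp [hc]) (by simp)]
    simp
  simp only [Finset.sum_add_distrib, ← Finset.mul_sum, h4, h3, h5]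
  rcases lt_trichotomy a b with h | h | h
  · simp [h, h.ne, h.not_gt]; ring
  · simp [h]
  · simp [h, h.ne', h.not_gt]; ring

/-- The matrix `M(x,y;k)`, with entries `M_{ab} = k ρ_{ba}(x,y) (B(x)^k)_{ab}`. -/
def PerfectCylindricalNetwork.laxM {V : Type u} {E : Type v} [Fintype V] [Fintype E] {N : ℕ}
    (G : PerfectCylindricalNetwork V E N N) {K : Type w} [Field K] (x y : K) (k : ℕ) :
    PMat K G.marked := fun a b =>
  ((k : K) * trigRho N x y b a) • PMat.pow (G.boundaryMeasurement K x) k a b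

end NCNetwork

end

noncomputable section

namespace NCNetwork

universe u v w

/-! ## Matrices over a path category and traces of powers -/

section Lax

variable {K : Type w} [Field K] {Q : Type u} [Quiver.{v} Q]

/-! The Lax equation follows from an r-matrix formula for the double bracket
(`br_boundaryMeasurement`): {{B(λ)_ij, B(μ)_kl}} = ρ_ik B(λ)_kj ⊗ B(μ)_il − ρ_lj B(μ)_kj ⊗ B(λ)_il.
Given it, the Leibniz rule and cyclicity of the trace turn the bracket with tr B(λ)^k into k times
the insertion of B(λ)^(k-1) between the two tensor factors (`insertion_pow`), and the two terms
become the two products with M (`hBracket_trace_pow`).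

For the formula, the bracket is expanded over pairs of paths i → j and k → l with a marked arrow on
each, the arrows meeting at an internal vertex. The bracket exchanges the initial parts of the
paths. After reindexing (`sum_tailBracket`, `sum_headBracket`) the sum runs over pairs p : k → j, q
: i → l. What remains is the total coefficient of a fixed pair: a sum of ±1/2 over corners, weighted
by powers of t = μ/λ whose exponents are differences of indices of initial parts
(`sum_splitWeight`).

These exponents are values of a height function. With its boundary circles collapsed the cylinder is
a sphere, so the flow of p minus that of q is the coboundary of an integral function h on the faces
(`exists_height`, a dimension count with Euler's formula). The cut measures the difference of height
between its two ends, and acyclicity localizes this: at an edge common to p and q, the height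
relative to the start of the cut is the index difference of the parts before that edge
(`pathIndex_sub_eq_of_common`).

The corner sum then telescopes along q. Give an edge the potential t^(h on its left) + t^(h on its
right + 1). Across each internal vertex of q it changes by 2(t − 1) times the contribution of the
corners there, whatever p does (`edgePotential_sub`). Only the first and last edges of q survive. At
source i the potential is 2, 1 + t or 2t according to i < k, i = k or i > k, which is 2(t − 1)ρ_ik.
At sink l it is 2(t − 1)ρ_lj times t^(ind p − ind q), and this power exchanges λ and μ in the second
term. -/

theorem concat_nil_left {a b : Q} (f : Mor K a b) :
    concat K a a b (ofPath K Quiver.Path.nil) f = f :=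
  LinearMap.congr_fun lmul_nil f

theorem concat_nil_right {a b : Q} (f : Mor K a b) :
    concat K a b b f (ofPath K Quiver.Path.nil) = f :=
  LinearMap.congr_fun rmul_nil f

namespace PMat

variable {ι : Type}

theorem one_self [DecidableEq ι] (x : ι → Q) (i : ι) : one K x i i = ofPath K Quiver.Path.nil := by
  simp [one]

theorem one_of_ne [DecidableEq ι] (x : ι → Q) {i j : ι} (h : i ≠ j) : one K x i j = 0 := by
  simp [one, h]

variable [Fintype ι] {x : ι → Q}

theorem mul_assoc (A B C : PMat K x) : mul (mul A B) C = mul A (mul B C) := by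
  funext i l
  simp only [mul, map_sum, LinearMap.sum_apply, concat_assoc]
  exact Finset.sum_comm

variable [DecidableEq ι]

theorem one_mul (A : PMat K x) : mul (one K x) A = A := by
  funext i l
  rw [mul, Finset.sum_eq_single i (fun j _ hj => by simp [one_of_ne x (Ne.symm hj)]) (by simp),
    one_self, concat_nil_left]

theorem mul_one (A : PMat K x) : mul A (one K x) = A := by
  funext i l
  rw [mul, Finset.sum_eq_single l (fun j _ hj => by simp [one_of_ne x hj]) (by simp),
    one_self, concat_nil_right]

theorem pow_mul_pow (A : PMat K x) (m n : ℕ) : mul (pow A m) (pow A n) = pow A (m + n) := by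
  induction n with
  | zero => exact mul_one _
  | succ n ih => rw [← add_assoc, pow, ← mul_assoc, ih, pow]

theorem mul_pow (A : PMat K x) (n : ℕ) : mul A (pow A n) = pow A (n + 1) := by
  have h : pow A 1 = A := one_mul A
  rw [add_comm, ← pow_mul_pow, h]

end PMat

/-! ### Inserting a matrix between the tensor factors of a double bracket -/

/-- `v ⊗ w ↦ (u ↦ v u w)`. -/
def sandwich (K : Type w) [Field K] (c b a d : Q) :
    Mor K c b ⊗[K] Mor K a d →ₗ[K] Mor K b a →ₗ[K] Mor K c d :=
  TensorProduct.lift (LinearMap.mk₂ K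
    (fun v w => ((concat K c a d).flip w).comp (concat K c b a v))
    (fun v v' w => by ext; simp) (fun r v w => by ext; simp)
    (fun v w w' => by ext; simp) (fun r v w => by ext; simp))

theorem sandwich_tmul {a b c d : Q} (v : Mor K c b) (w : Mor K a d) (u : Mor K b a) :
    sandwich K c b a d (v ⊗ₜ w) u = concat K c a d (concat K c b a v u) w := by
  simp [sandwich]

/-- The Leibniz rule in the first argument multiplies at the inner ends of the tensor, next to the
inserted morphism, so associativity absorbs the factor into that morphism. -/
theorem sandwich_map_lmul {a a' b c d : Q} (f : Mor K a a') (t : Mor K c b ⊗[K] Mor K a' d)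
    (u : Mor K b a) :
    sandwich K c b a d (TensorProduct.map LinearMap.id (lmul K d f) t) u =
      sandwich K c b a' d t (concat K b a a' u f) := by
  induction t using TensorProduct.induction_on with
  | zero => simp
  | tmul v w => simp [sandwich_tmul, concat_assoc]
  | add s t hs ht => simp only [map_add, LinearMap.add_apply, hs, ht]

theorem sandwich_map_rmul {a b b' c d : Q} (f : Mor K b' b) (t : Mor K c b' ⊗[K] Mor K a d)
    (u : Mor K b a) :
    sandwich K c b a d (TensorProduct.map (rmul K c f) LinearMap.id t) u =
      sandwich K c b' a d t (concat K b' b a f u) := by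
  induction t using TensorProduct.induction_on with
  | zero => simp
  | tmul v w => simp [sandwich_tmul, concat_assoc]
  | add s t hs ht => simp only [map_add, LinearMap.add_apply, hs, ht]

theorem sandwich_nil {a c d : Q} (t : Mor K c a ⊗[K] Mor K a d) :
    sandwich K c a a d t (ofPath K Quiver.Path.nil) = TensorProduct.lift (concat K c a d) t := by
  induction t using TensorProduct.induction_on with
  | zero => simp
  | tmul v w => simp [sandwich_tmul, concat_nil_right]
  | add s t hs ht => simp only [map_add, LinearMap.add_apply, hs, ht]

namespace DoubleBracket

variable (D : DoubleBracket K Q) {ι : Type} [Fintype ι] {x : ι → Q} {c d : Q}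

/-- `∑_{ij} {{X_ij, h}}' C_ji {{X_ij, h}}''`. -/
def insertion (X C : PMat K x) (h : Mor K c d) : Mor K c d :=
  ∑ i, ∑ j, sandwich K c (x j) (x i) d (D.br (x i) (x j) c d (X i j) h) (C j i)

/-- Each Leibniz term leaves the undifferentiated factor adjacent to `C`: `X` lands on its right,
`Y` on its left. This is the cyclic rotation of a trace. -/
theorem insertion_mul (X Y C : PMat K x) (h : Mor K c d) :
    D.insertion (PMat.mul X Y) C h =
      D.insertion Y (PMat.mul C X) h + D.insertion X (PMat.mul Y C) h := by
  have h1 : D.insertion (PMat.mul X Y) C h = ∑ i, ∑ l, ∑ j,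
      (sandwich K c (x l) (x j) d (D.br (x j) (x l) c d (Y j l) h)
          (concat K _ _ _ (C l i) (X i j)) +
        sandwich K c (x j) (x i) d (D.br (x i) (x j) c d (X i j) h)
          (concat K _ _ _ (Y j l) (C l i))) := by
    refine Finset.sum_congr rfl fun i _ => Finset.sum_congr rfl fun l _ => ?_
    simp only [PMat.mul, map_sum, LinearMap.sum_apply, D.leibniz_left, map_add,
      LinearMap.add_apply, sandwich_map_lmul, sandwich_map_rmul]
  rw [h1]
  simp only [Finset.sum_add_distrib]
  congr 1
  · simp only [insertion, PMat.mul, map_sum]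
    rw [Finset.sum_comm]
    conv_rhs => rw [Finset.sum_comm]
    refine Finset.sum_congr rfl fun i _ => Finset.sum_comm
  · simp only [insertion, PMat.mul, map_sum]
    refine Finset.sum_congr rfl fun i _ => Finset.sum_comm

variable [DecidableEq ι]

/-- For the product 1 · 1 the rule `insertion_mul` reads I = I + I. -/
theorem insertion_one (C : PMat K x) (h : Mor K c d) : D.insertion (PMat.one K x) C h = 0 := by
  have := D.insertion_mul (PMat.one K x) (PMat.one K x) C h
  rwa [PMat.one_mul, PMat.mul_one, PMat.one_mul, left_eq_add] at this

/-- Powers of `A` commute, so every factor of the power contributes the same term. The exponent `m`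
is kept general because splitting off a factor moves it into the inserted power. -/
theorem insertion_pow (A : PMat K x) (k m : ℕ) (h : Mor K c d) :
    D.insertion (PMat.pow A (k + 1)) (PMat.pow A m) h =
      (k + 1) • D.insertion A (PMat.pow A (k + m)) h := by
  induction k generalizing m with
  | zero =>
    have : PMat.pow A (0 + 1) = A := PMat.one_mul A
    rw [this]; simp
  | succ k ih =>
    rw [PMat.pow, insertion_mul, PMat.pow_mul_pow, PMat.mul_pow, ih, add_comm m,
      show k + (m + 1) = k + 1 + m by ring]
    rw [succ_nsmul (n := k + 1), add_comm]

/-- The identity matrix kills the off-diagonal terms, and inserting an empty path is plain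
concatenation of the tensor factors. -/
theorem hBracket_cyclicTrace (X : PMat K x) (i j : ι) (h : Mor K (x i) (x j)) :
    D.hBracket x i j (PMat.cyclicTrace X) h = D.insertion X (PMat.one K x) h := by
  have h1 : D.hBracket x i j (PMat.cyclicTrace X) =
      ∑ l, D.loopBracket (x l) (x i) (x j) (X l l) := by
    simp only [hBracket, PMat.cyclicTrace, Submodule.mkQ_apply, Submodule.liftQ_apply, map_sum,
      DirectSum.toModule_lof]
  rw [h1, LinearMap.sum_apply]
  refine Finset.sum_congr rfl fun l _ => ?_
  rw [Finset.sum_eq_single l (fun m _ hm => by rw [PMat.one_of_ne x hm, map_zero]) (by simp),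
    PMat.one_self, sandwich_nil]
  rfl

/-- The Lax equation for a matrix whose brackets are given by an `r`-matrix. -/
theorem hBracket_trace_pow (A B : PMat K x) (ρ : ι → ι → K)
    (hAB : ∀ i j k l, D.br (x i) (x j) (x k) (x l) (A i j) (B k l) =
      ρ i k • (A k j ⊗ₜ[K] B i l) - ρ l j • (B k j ⊗ₜ[K] A i l))
    (k : ℕ) (b₁ b₂ : ι) :
    D.hBracket x b₁ b₂ (PMat.cyclicTrace (PMat.pow A k)) (B b₁ b₂) =
      PMat.mul (fun a b => ((k : K) * ρ b a) • PMat.pow A k a b) B b₁ b₂ -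
        PMat.mul B (fun a b => ((k : K) * ρ b a) • PMat.pow A k a b) b₁ b₂ := by
  rw [hBracket_cyclicTrace]
  cases k with
  | zero =>
    rw [show PMat.pow A 0 = PMat.one K x from rfl, insertion_one]
    simp [PMat.mul]
  | succ k =>
    have h0 := D.insertion_pow A k 0 (B b₁ b₂)
    rw [show PMat.pow A 0 = PMat.one K x from rfl] at h0
    rw [h0, add_zero, ← Nat.cast_smul_eq_nsmul K]
    -- The inserted power meets the remaining factor `A`, on its left in the first term and on its
    -- right in the second, and completes it to `A ^ (k + 1)`. The other summation index becomes
    -- that of a product with `B`.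
    have h1 : D.insertion A (PMat.pow A k) (B b₁ b₂) =
        ∑ i, ρ i b₁ • concat K _ _ _ (PMat.pow A (k + 1) b₁ i) (B i b₂) -
          ∑ j, ρ b₂ j • concat K _ _ _ (B b₁ j) (PMat.pow A (k + 1) j b₂) := by
      have h2 : ∀ i, PMat.pow A (k + 1) b₁ i =
          ∑ j, concat K _ _ _ (A b₁ j) (PMat.pow A k j i) := fun i => by
        rw [← PMat.mul_pow]; rfl
      have h3 : ∀ j, PMat.pow A (k + 1) j b₂ =
          ∑ i, concat K _ _ _ (PMat.pow A k j i) (A i b₂) := fun j => rfl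
      simp only [insertion, hAB, map_sub, map_smul, LinearMap.sub_apply, LinearMap.smul_apply,
        sandwich_tmul, Finset.sum_sub_distrib, h2, h3, map_sum, LinearMap.sum_apply,
        Finset.smul_sum]
      congr 1
      rw [Finset.sum_comm]
      simp only [concat_assoc]
    rw [h1, smul_sub, Finset.smul_sum, Finset.smul_sum]
    simp only [PMat.mul, map_smul, LinearMap.smul_apply, mul_smul]

end DoubleBracket

end Lax

/-! ## Height functions of planar flows -/

theorem eq_of_comp_finRotate {N : ℕ} {X : Type*} (f : Fin N → X)
    (h : ∀ i, f (finRotate N i) = f i) (i j : Fin N) : f i = f j := by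
  cases N with
  | zero => exact i.elim0
  | succ n =>
    have key : ∀ i : Fin (n + 1), f i = f 0 := by
      intro i
      induction i using Fin.induction with
      | zero => rfl
      | succ i ih =>
        rw [← ih, ← h i.castSucc]
        congr 1
        rw [finRotate_apply, Fin.coeSucc_eq_succ]
    rw [key i, key j]

/-- Invariance is required only along the cycle of `d`, since heights will be constant only around
vertices free of flow. -/
theorem eq_of_sameCycle {α X : Type*} {σ : Equiv.Perm α} {f : α → X} {d d' : α}
    (hf : ∀ c, σ.SameCycle d c → f (σ c) = f c) (h : σ.SameCycle d d') : f d' = f d := by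
  obtain ⟨n, rfl⟩ := h
  induction n using Int.induction_on with
  | zero => rfl
  | succ n ih =>
    rw [← ih, ← hf _ ⟨n, rfl⟩, add_comm, zpow_add, zpow_one, Equiv.Perm.mul_apply]
  | pred n ih =>
    rw [← ih, ← hf _ ⟨-n - 1, rfl⟩, ← Equiv.Perm.mul_apply, ← zpow_one_add]
    congr 3
    ring

namespace PerfectCylindricalNetwork

variable {V : Type u} {E : Type v} [Fintype V] [Fintype E] {N : ℕ}
  (G : PerfectCylindricalNetwork V E N N)

/-- The vertices after collapsing the boundary circles: the source circle becomes `inl false`, the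
sink circle `inl true`. -/
def collapse : CylVertex V N N → Bool ⊕ V
  | .source _ => Sum.inl false
  | .inner v => Sum.inr v
  | .sink _ => Sum.inl true

theorem dartVertex_eq_source {d : E × Bool} {i : Fin N} (h : G.dartVertex d = .source i) :
    d = (G.sourceEdge i, false) := by
  obtain ⟨e, b⟩ := d
  cases b
  · rw [(G.src_eq_source e i).1 h]
  · exact absurd h (G.tgt_ne_source e i)

theorem dartVertex_eq_sink {d : E × Bool} {i : Fin N} (h : G.dartVertex d = .sink i) :
    d = (G.sinkEdge i, true) := by
  obtain ⟨e, b⟩ := d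
  cases b
  · exact absurd h (G.src_ne_sink e i)
  · rw [(G.tgt_eq_sink e i).1 h]

theorem src_sourceEdge (i : Fin N) : G.src (G.sourceEdge i) = .source i :=
  (G.src_eq_source _ i).2 rfl

theorem tgt_sinkEdge (i : Fin N) : G.tgt (G.sinkEdge i) = .sink i :=
  (G.tgt_eq_sink _ i).2 rfl

theorem dartVertex_rot_inner {d : E × Bool} {v : V} (h : G.dartVertex d = .inner v) :
    G.dartVertex (G.rot d) = .inner v :=
  (G.rot_inner v d _ h).1 (Equiv.Perm.sameCycle_apply_right.2 (Equiv.Perm.SameCycle.refl _ _))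

/-- The rotation runs through all sources, or all sinks, so it fixes a vertex only after each
boundary circle is collapsed to a point. -/
theorem collapse_dartVertex_rot (d : E × Bool) :
    collapse (G.dartVertex (G.rot d)) = collapse (G.dartVertex d) := by
  cases h : G.dartVertex d with
  | inner v => rw [G.dartVertex_rot_inner h]
  | source i =>
    rw [G.dartVertex_eq_source h]
    obtain ⟨i, rfl⟩ := (finRotate N).surjective i
    rw [G.rot_source, RibbonNetwork.dartVertex, G.src_sourceEdge]
    rfl
  | sink i =>
    rw [G.dartVertex_eq_sink h, G.rot_sink, RibbonNetwork.dartVertex, G.tgt_sinkEdge]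
    rfl

/-! ### Reachability and connectedness -/

/-- The tail of an edge. -/
def srcPt (e : E) : G.Pt := G.src e

/-- The head of an edge. -/
def tgtPt (e : E) : G.Pt := G.tgt e

/-- An edge as an arrow. -/
def arrow (e : E) : G.srcPt e ⟶ G.tgtPt e := ⟨e, rfl, rfl⟩

/-- The reachability order on edges. -/
def Precedes (e e' : E) : Prop := Nonempty (Quiver.Path (G.tgtPt e) (G.srcPt e'))

variable {G} in
theorem Precedes.trans {a b c : E} : G.Precedes a b → G.Precedes b c → G.Precedes a c :=
  fun ⟨p⟩ ⟨q⟩ => ⟨(p.cons (G.arrow b)).comp q⟩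

theorem not_precedes_self (a : E) : ¬G.Precedes a a := fun ⟨p⟩ => by
  have := G.acyclic _ (p.cons (G.arrow a))
  cases this

theorem precedes_of_eq {e e' : E} (h : G.tgt e = G.src e') : G.Precedes e e' :=
  ⟨Quiver.Path.nil.cast rfl (show G.tgtPt e = G.srcPt e' from h)⟩

/-- Noetherian induction along the edges, starting at the sinks. -/
theorem edge_induction {P : E → Prop} (h : ∀ e, (∀ e', G.src e' = G.tgt e → P e') → P e)
    (e : E) : P e := by
  have : IsTrans E (fun a b => G.Precedes b a) := ⟨fun a b c h1 h2 => h2.trans h1⟩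
  have : Std.Irrefl (fun a b => G.Precedes b a) := ⟨G.not_precedes_self⟩
  have wf : WellFounded (fun a b => G.Precedes b a) := Finite.wellFounded_of_trans_of_irrefl _
  induction e using wf.induction with
  | _ e ih => exact h e fun e' he' => ih e' (G.precedes_of_eq he'.symm)

/-- Noetherian induction along the edges, starting at the sources. -/
theorem edge_induction_source {P : E → Prop}
    (h : ∀ e, (∀ e', G.tgt e' = G.src e → P e') → P e) (e : E) : P e := by
  have : IsTrans E G.Precedes := ⟨fun a b c h1 h2 => h1.trans h2⟩
  have : Std.Irrefl G.Precedes := ⟨G.not_precedes_self⟩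
  have wf : WellFounded G.Precedes := Finite.wellFounded_of_trans_of_irrefl _
  induction e using wf.induction with
  | _ e ih => exact h e fun e' he' => ih e' (G.precedes_of_eq he')

/-- Connectedness of the collapsed graph: by acyclicity and finiteness, following outgoing edges
from any vertex ends on the sink circle. -/
theorem eq_of_invariant {X : Type*} (φ : Bool ⊕ V → X) [NeZero N]
    (h : ∀ e, φ (collapse (G.tgt e)) = φ (collapse (G.src e))) (a : Bool ⊕ V) :
    φ a = φ (Sum.inl true) := by
  have key : ∀ e, φ (collapse (G.tgt e)) = φ (Sum.inl true) := by
    intro e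
    induction e using G.edge_induction with
    | _ e ih =>
      cases ht : G.tgt e with
      | source i => exact absurd ht (G.tgt_ne_source e i)
      | sink i => rfl
      | inner v =>
        obtain ⟨e', he'⟩ := G.exists_out v
        have := ih e' (he'.trans ht.symm)
        rwa [h, he'] at this
  rcases a with (_ | _) | v
  · have := key (G.sourceEdge 0)
    rwa [h, G.src_sourceEdge] at this
  · rfl
  · obtain ⟨e', he'⟩ := G.exists_out v
    have := key e'
    rwa [h, he'] at this

/-- The same walk to the sinks, on darts: `flip` moves along an edge and `G.rot` around a vertex. It
will show that the only functions on faces with zero coboundary are the constants. -/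
theorem dart_eq_of_invariant {X : Type*} (f : E × Bool → X) [NeZero N]
    (hflip : ∀ d, f (RibbonNetwork.flip d) = f d) (hrot : ∀ d, f (G.rot d) = f d)
    (d : E × Bool) : f d = f (G.sinkEdge 0, true) := by
  have key : ∀ e, f (e, true) = f (G.sinkEdge 0, true) := by
    intro e
    induction e using G.edge_induction with
    | _ e ih =>
      cases ht : G.tgt e with
      | source i => exact absurd ht (G.tgt_ne_source e i)
      | sink i =>
        rw [(G.tgt_eq_sink e i).1 ht]
        exact eq_of_comp_finRotate (fun i => f (G.sinkEdge i, true))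
          (fun i => by rw [← G.rot_sink, hrot]) i 0
      | inner v =>
        obtain ⟨e', he'⟩ := G.exists_out v
        rw [← ih e' (he'.trans ht.symm), ← eq_of_sameCycle (fun d _ => hrot d) (d := (e, true)) (d' := (e', false)), ← hflip]
        · rfl
        · exact (G.rot_inner v (e, true) _ ht).2 he'
  obtain ⟨e, _ | _⟩ := d
  · rw [← hflip]; exact key e
  · exact key e

/-- Coboundaries from faces are orthogonal to coboundaries from vertices. Since `G.facePerm d` sits
at the far end of `d` and has the same face, reindexing by `G.facePerm` shows that ∑ h·φ over darts
is the same with φ taken at either end. -/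
theorem sum_coboundary_mul (h : E × Bool → ℚ) (hf : ∀ d, h (G.facePerm d) = h d)
    (φ : Bool ⊕ V → ℚ) :
    ∑ e, (h (e, true) - h (e, false)) * (φ (collapse (G.tgt e)) - φ (collapse (G.src e))) = 0 := by
  have h1 : ∑ d, h d * φ (collapse (G.dartVertex d)) =
      ∑ d, h d * φ (collapse (G.dartVertex (RibbonNetwork.flip d))) := by
    rw [← Equiv.sum_comp G.facePerm]
    refine Finset.sum_congr rfl fun d _ => ?_
    rw [hf, ← G.collapse_dartVertex_rot (G.facePerm d)]
    simp [RibbonNetwork.facePerm]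
  simp only [Fintype.sum_prod_type, Fintype.sum_bool, RibbonNetwork.flip,
    RibbonNetwork.dartVertex, Bool.not_true, Bool.not_false] at h1
  rw [← sub_eq_zero, ← Finset.sum_sub_distrib] at h1
  rw [← h1]
  exact Finset.sum_congr rfl fun e _ => by ring

/-- Since the collapsed surface is a sphere, every flow is the coboundary of a function on faces. -/
theorem exists_height_rat [NeZero N] (z : E → ℚ)
    (hz : ∀ φ : Bool ⊕ V → ℚ,
      ∑ e, z e * (φ (collapse (G.tgt e)) - φ (collapse (G.src e))) = 0) :
    ∃ h : E × Bool → ℚ, (∀ d, h (G.facePerm d) = h d) ∧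
      ∀ e, h (e, true) - h (e, false) = z e := by
  classical
  let F := Quotient (Equiv.Perm.SameCycle.setoid G.facePerm)
  let q : E × Bool → F := fun d => Quotient.mk _ d
  let : Fintype F := Fintype.ofFinite F
  have hq : ∀ d, q (G.facePerm d) = q d := fun d =>
    Quotient.sound (Equiv.Perm.sameCycle_apply_left.2 (Equiv.Perm.SameCycle.refl _ _))
  let δ : (F → ℚ) →ₗ[ℚ] (E → ℚ) :=
    { toFun := fun h e => h (q (e, true)) - h (q (e, false))
      map_add' := fun h h' => by funext e; simp only [Pi.add_apply]; ring
      map_smul' := fun c h => by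
        funext e; simp only [Pi.smul_apply, smul_eq_mul, RingHom.id_apply]; ring }
  let δ' : (Bool ⊕ V → ℚ) →ₗ[ℚ] (E → ℚ) :=
    { toFun := fun φ e => φ (collapse (G.tgt e)) - φ (collapse (G.src e))
      map_add' := fun h h' => by funext e; simp only [Pi.add_apply]; ring
      map_smul' := fun c h => by
        funext e; simp only [Pi.smul_apply, smul_eq_mul, RingHom.id_apply]; ring }
  have hδ : ∀ h e, δ h e = h (q (e, true)) - h (q (e, false)) := fun h e => rfl
  have hδ' : ∀ φ e, δ' φ e = φ (collapse (G.tgt e)) - φ (collapse (G.src e)) := fun φ e => rfl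
  let W : Submodule ℚ (E → ℚ) :=
    { carrier := {z | ∀ φ, ∑ e, z e * δ' φ e = 0}
      zero_mem' := fun φ => by simp
      add_mem' := fun {a b} ha hb φ => by
        simp only [Pi.add_apply, add_mul, Finset.sum_add_distrib, ha φ, hb φ, add_zero]
      smul_mem' := fun c a ha φ => by
        simp only [Pi.smul_apply, smul_eq_mul, mul_assoc, ← Finset.mul_sum, ha φ, mul_zero] }
  have hle : LinearMap.range δ ≤ W := by
    rintro _ ⟨h, rfl⟩ φ
    exact G.sum_coboundary_mul (fun d => h (q d)) (fun d => by rw [hq]) φ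
  -- Over ℚ a vector orthogonal to itself is zero; this is why the count is made with rational
  -- coefficients.
  have hdisj : Disjoint W (LinearMap.range δ') := by
    rw [Submodule.disjoint_def]
    rintro _ hx ⟨φ, rfl⟩
    have h0 := hx φ
    rw [Finset.sum_eq_zero_iff_of_nonneg (fun e _ => mul_self_nonneg _)] at h0
    funext e
    exact mul_self_eq_zero.1 (h0 e (Finset.mem_univ e))
  have hker' : Module.finrank ℚ (LinearMap.ker δ') ≤ 1 := by
    refine finrank_le_one ⟨fun _ => 1, ?_⟩ ?_
    · rw [LinearMap.mem_ker]; funext e; simp [hδ']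
    · rintro ⟨φ, hφ⟩
      refine ⟨φ (Sum.inl true), Subtype.ext (funext fun a => ?_)⟩
      have := G.eq_of_invariant φ (fun e => by
        have := congrFun (LinearMap.mem_ker.1 hφ) e
        rw [hδ'] at this
        exact sub_eq_zero.1 this) a
      simp [this]
  have hker : Module.finrank ℚ (LinearMap.ker δ) ≤ 1 := by
    refine finrank_le_one ⟨fun _ => 1, ?_⟩ ?_
    · rw [LinearMap.mem_ker]; funext e; simp [hδ]
    · rintro ⟨h, hh⟩
      have hfl : ∀ d, h (q (RibbonNetwork.flip d)) = h (q d) := by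
        have h1 : ∀ e, h (q (e, true)) = h (q (e, false)) := fun e => by
          have := congrFun (LinearMap.mem_ker.1 hh) e
          rw [hδ] at this
          exact sub_eq_zero.1 this
        rintro ⟨e, _ | _⟩
        · exact h1 e
        · exact (h1 e).symm
      refine ⟨h (q (G.sinkEdge 0, true)), Subtype.ext (funext fun a => ?_)⟩
      obtain ⟨d, rfl⟩ := Quotient.exists_rep a
      have := G.dart_eq_of_invariant (fun d => h (q d)) hfl (fun d => by
        have h2 := hq (RibbonNetwork.flip (G.rot d))
        have h3 : G.facePerm (RibbonNetwork.flip (G.rot d)) = d := G.facePerm.apply_symm_apply d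
        rw [h3] at h2
        rw [h2, hfl]) d
      simpa using this.symm
  have r1 := LinearMap.finrank_range_add_finrank_ker δ
  have r2 := LinearMap.finrank_range_add_finrank_ker δ'
  have r3 := Submodule.finrank_add_finrank_le_of_disjoint hdisj
  simp only [Module.finrank_fintype_fun_eq_card, Fintype.card_sum, Fintype.card_bool] at r1 r2 r3
  have r4 := G.euler
  rw [RibbonNetwork.numFaces, Nat.card_eq_fintype_card] at r4
  change ((Fintype.card V + 2 : ℕ) : ℤ) - Fintype.card E + Fintype.card F = 2 at r4
  -- The kernels have dimension at most 1, so `δ` has rank at least |F| − 1 and `δ'` rank at least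
  -- |V| + 1. Disjointness then gives dim W ≤ |E| − |V| − 1, which is |F| − 1 by Euler's formula.
  have heq : LinearMap.range δ = W := Submodule.eq_of_le_of_finrank_le hle (by omega)
  obtain ⟨h, hh⟩ : z ∈ LinearMap.range δ := heq ▸ (show z ∈ W from hz)
  exact ⟨fun d => h (q d), fun d => congrArg h (hq d), fun e => congrFun hh e⟩

/-- Integral flows are coboundaries of integral functions on faces. -/
theorem exists_height [NeZero N] (z : E → ℤ)
    (hz : ∀ φ : Bool ⊕ V → ℚ,
      ∑ e, (z e : ℚ) * (φ (collapse (G.tgt e)) - φ (collapse (G.src e))) = 0) :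
    ∃ h : E × Bool → ℤ, (∀ d, h (G.facePerm d) = h d) ∧
      ∀ e, h (e, true) = h (e, false) + z e := by
  obtain ⟨h, h1, h2⟩ := G.exists_height_rat (fun e => (z e : ℚ)) hz
  -- The jumps are integers, so taking floors preserves them.
  refine ⟨fun d => ⌊h d⌋, fun d => congrArg _ (h1 d), fun e => ?_⟩
  rw [← Int.floor_add_intCast, ← h2, add_sub_cancel]

end PerfectCylindricalNetwork

/-! ## Intersection indices and heights -/

namespace PerfectCylindricalNetwork

variable {V : Type u} {E : Type v} [Fintype V] [Fintype E] {N : ℕ}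
  (G : PerfectCylindricalNetwork V E N N)

theorem edgeList_comp {a b c : G.Pt} (p : Quiver.Path a b) (q : Quiver.Path b c) :
    G.edgeList (p.comp q) = G.edgeList q ++ G.edgeList p := by
  induction q with
  | nil => rfl
  | cons q e ih => rw [Quiver.Path.comp_cons, edgeList, edgeList, ih, List.cons_append]

theorem exists_eq_of_mem_edgeList {a b : G.Pt} (p : Quiver.Path a b) {e : E}
    (he : e ∈ G.edgeList p) : ∃ (p₁ : Quiver.Path a (G.srcPt e)) (p₂ : Quiver.Path (G.tgtPt e) b),
      p = (p₁.cons (G.arrow e)).comp p₂ := by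
  induction p with
  | nil => simp [edgeList] at he
  | cons p f ih =>
    rw [edgeList, List.mem_cons] at he
    rcases he with rfl | he
    · obtain ⟨f, rfl, rfl⟩ := f
      exact ⟨p, Quiver.Path.nil, rfl⟩
    · obtain ⟨p₁, p₂, rfl⟩ := ih he
      exact ⟨p₁, p₂.cons f, rfl⟩

theorem pathIndex_comp {a b c : G.Pt} (p : Quiver.Path a b) (q : Quiver.Path b c) :
    G.pathIndex (p.comp q) = G.pathIndex p + G.pathIndex q := by
  simp [pathIndex, edgeList_comp, add_comm]

theorem pathIndex_cons {a b c : G.Pt} (p : Quiver.Path a b) (e : b ⟶ c) :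
    G.pathIndex (p.cons e) = G.pathIndex p + G.edgeIndex e.1 := by
  simp [pathIndex, edgeList, add_comm]

/-! ### Flows of paths and their heights -/

open Classical in
/-- The number of times that a path uses an edge. -/
def flow {a b : G.Pt} (p : Quiver.Path a b) (e : E) : ℤ := (G.edgeList p).count e

theorem flow_comp {a b c : G.Pt} (p : Quiver.Path a b) (q : Quiver.Path b c) (e : E) :
    G.flow (p.comp q) e = G.flow p e + G.flow q e := by
  simp [flow, edgeList_comp, add_comm]

open Classical in
theorem flow_cons {a b c : G.Pt} (p : Quiver.Path a b) (f : b ⟶ c) (e : E) :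
    G.flow (p.cons f) e = G.flow p e + if f.1 = e then 1 else 0 := by
  simp [flow, edgeList, List.count_cons]

open Classical in
theorem flow_eq {a b : G.Pt} (p : Quiver.Path a b) (e : E) :
    G.flow p e = if e ∈ G.edgeList p then 1 else 0 := by
  rw [flow]
  split_ifs with h
  · rw [List.count_eq_one_of_mem (G.edgeList_nodup p) h]; rfl
  · rw [List.count_eq_zero_of_not_mem h]; rfl

theorem mem_of_flow_ne_zero {a b : G.Pt} {p : Quiver.Path a b} {e : E} (h : G.flow p e ≠ 0) :
    e ∈ G.edgeList p := by
  by_contra h'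
  exact h (by rw [flow_eq, if_neg h'])

theorem sum_flow_mul {R : Type*} [CommRing R] {a b : G.Pt} (p : Quiver.Path a b) (f : E → R) :
    ∑ e, (G.flow p e : R) * f e = ((G.edgeList p).map f).sum := by
  classical
  induction p with
  | nil => simp [flow, edgeList]
  | cons p e ih =>
    simp only [flow_cons, Int.cast_add, add_mul, Finset.sum_add_distrib, ih, edgeList,
      List.map_cons, List.sum_cons]
    rw [add_comm]
    simp

theorem sum_flow_mul_sub {R : Type*} [CommRing R] {a b : G.Pt} (p : Quiver.Path a b)
    (φ : CylVertex V N N → R) :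
    ∑ e, (G.flow p e : R) * (φ (G.tgt e) - φ (G.src e)) = φ b - φ a := by
  rw [sum_flow_mul]
  induction p with
  | nil => simp [edgeList]
  | cons p e ih =>
    obtain ⟨e, rfl, rfl⟩ := e
    simp [edgeList, ih]

/-- A function on faces, seen as a function on darts, with coboundary `z`. -/
structure IsHeight (z : E → ℤ) (h : E × Bool → ℤ) : Prop where
  face : ∀ d, h (G.facePerm d) = h d
  jump : ∀ e, h (e, true) = h (e, false) + z e

/-- Paths with the same collapsed endpoints have flows with the same boundary, so the difference of
the flows is closed and has a height. -/
theorem exists_isHeight [NeZero N] {a b a' b' : G.Pt} (p : Quiver.Path a b)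
    (q : Quiver.Path a' b') (ha : collapse (N := N) a = collapse (N := N) a')
    (hb : collapse (N := N) b = collapse (N := N) b') :
    ∃ h, G.IsHeight (fun e => G.flow p e - G.flow q e) h := by
  obtain ⟨h, h1, h2⟩ := G.exists_height (fun e => G.flow p e - G.flow q e) (fun φ => by
    simp only [Int.cast_sub, sub_mul, Finset.sum_sub_distrib]
    rw [G.sum_flow_mul_sub p (fun a => φ (collapse a)),
      G.sum_flow_mul_sub q (fun a => φ (collapse a)), ha, hb, sub_self])
  exact ⟨h, h1, h2⟩

namespace IsHeight

variable {G} {z : E → ℤ} {h : E × Bool → ℤ} (H : G.IsHeight z h)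
include H

theorem sub {z' : E → ℤ} {h' : E × Bool → ℤ} (H' : G.IsHeight z' h') :
    G.IsHeight (fun e => z e - z' e) (fun d => h d - h' d) where
  face d := by rw [H.face, H'.face]
  jump e := by rw [H.jump, H'.jump]; ring

/-- The corner from `d` counterclockwise to `G.rot d` lies to the left of the first and to the right
of the second. -/
theorem flip_rot (d : E × Bool) : h (RibbonNetwork.flip (G.rot d)) = h d := by
  rw [← H.face]
  exact congrArg h (G.facePerm.apply_symm_apply d)

theorem rot_of_eq_zero {d : E × Bool} (hd : z (G.rot d).1 = 0) : h (G.rot d) = h d := by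
  rw [← H.flip_rot d]
  rcases hr : G.rot d with ⟨e, _ | _⟩
  · rw [hr] at hd
    have := H.jump e
    rw [hd, add_zero] at this
    exact this.symm
  · rw [hr] at hd
    have := H.jump e
    rw [hd, add_zero] at this
    exact this

theorem rot_head {d : E × Bool} {e : E} (hd : G.rot d = (e, true)) : h (e, true) = h d + z e := by
  rw [H.jump, ← H.flip_rot d, hd]
  rfl

theorem rot_tail {d : E × Bool} {e : E} (hd : G.rot d = (e, false)) :
    h (e, false) = h d - z e := by
  rw [← H.flip_rot d, hd, RibbonNetwork.flip, Bool.not_false, H.jump, add_sub_cancel_right]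

theorem eq_of_sameFace {d d' : E × Bool} (hd : G.SameFace d d') : h d' = h d :=
  eq_of_sameCycle (fun c _ => H.face c) hd

-- Crossing a letter of the curve changes the height by `z e` at a tail half and by `-z e` at a head
-- half; the changes telescope from the first face to the last.
open Classical in
theorem sum_mul_count {l : List (E × Bool)} {d d' : E × Bool}
    (hl : G.IsTransversalCurve d l d') :
    ∑ e, z e * ((l.count (e, false) : ℤ) - l.count (e, true)) = h d' - h d := by
  induction l generalizing d with
  | nil => simp [H.eq_of_sameFace hl]
  | cons c l ih =>
    obtain ⟨h1, h2⟩ := hl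
    have h3 := ih h2
    rw [← H.eq_of_sameFace h1]
    have h4 : ∑ e, z e * (((c :: l).count (e, false) : ℤ) - (c :: l).count (e, true)) =
        ∑ e, z e * ((l.count (e, false) : ℤ) - l.count (e, true)) +
          ∑ e, z e * ((if c = (e, false) then 1 else 0) - (if c = (e, true) then 1 else 0)) := by
      rw [← Finset.sum_add_distrib]
      refine Finset.sum_congr rfl fun e _ => ?_
      simp only [List.count_cons, beq_iff_eq]
      push_cast
      ring
    rw [h4, h3]
    obtain ⟨e, _ | _⟩ := c <;>
    · have := H.jump e
      simp [RibbonNetwork.flip]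
      linarith

theorem sum_mul_edgeIndex [NeZero N] :
    ∑ e, z e * G.edgeIndex e = h (G.sinkEdge 0, false) - h (G.sourceEdge 0, false) :=
  H.sum_mul_count (G.isCut 0 0 rfl rfl)

/-- A height is constant downstream of its flow. -/
theorem eq_sink [NeZero N] {g : E} (h1 : ∀ e, z e ≠ 0 → G.Precedes e g)
    (h2 : ∀ j, z (G.sinkEdge j) = 0) {e : E} (he : e = g ∨ G.Precedes g e) :
    h (e, false) = h (G.sinkEdge 0, false) := by
  induction e using G.edge_induction with
  | _ e ih =>
    rw [← H.face (e, false)]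
    cases ht : G.tgt e with
    | source i => exact absurd ht (G.tgt_ne_source e i)
    | sink i =>
      have key : ∀ j, h (G.sinkEdge j, true) = h (G.sinkEdge 0, true) := fun j =>
        eq_of_comp_finRotate (fun i => h (G.sinkEdge i, true)) (fun i => by
          rw [← G.rot_sink, H.rot_of_eq_zero]
          rw [G.rot_sink]; exact h2 _) j 0
      obtain ⟨j, rfl⟩ := (finRotate N).surjective i
      have h3 : G.facePerm (e, false) = (G.sinkEdge j, true) := by
        show G.rot.symm (e, true) = _
        rw [Equiv.symm_apply_eq, G.rot_sink, (G.tgt_eq_sink e _).1 ht]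
      rw [h3, key, H.jump, h2, add_zero]
    | inner v =>
      -- An edge with flow precedes `g`, while `g` reaches the vertex `v`; an edge with flow at `v`
      -- would therefore close a directed cycle through `g`. Hence the height is constant around
      -- `v`.
      have hv : ∀ d, G.dartVertex d = .inner v → z d.1 = 0 := by
        intro d hd
        by_contra hz
        have hdg := h1 _ hz
        have hed : G.Precedes g d.1 ∨ G.tgt g = G.tgt d.1 := by
          obtain ⟨d, _ | _⟩ := d
          · have h4 := G.precedes_of_eq (ht.trans hd.symm)
            rcases he with rfl | he
            · exact Or.inl h4
            · exact Or.inl (he.trans h4)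
          · rcases he with rfl | ⟨⟨p⟩⟩
            · exact Or.inr (ht.trans hd.symm)
            · obtain ⟨q⟩ := hdg
              have h5 : G.tgtPt e = G.tgtPt d := ht.trans hd.symm
              have h6 := G.acyclic _ (((Quiver.Path.cons p (G.arrow e)).cast rfl h5).comp (q.cons (G.arrow g)))
              cases h6
        rcases hed with hed | hed
        · exact G.not_precedes_self _ (hed.trans hdg)
        · obtain ⟨q⟩ := hdg
          exact G.not_precedes_self g ⟨q.cast hed.symm rfl⟩
      obtain ⟨e', he'⟩ := G.exists_out v
      have hc : G.rot.SameCycle (e', false) (G.facePerm (e, false)) := by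
        refine (Equiv.Perm.SameCycle.trans ?_ (Equiv.Perm.sameCycle_symm_apply_right.2
          (Equiv.Perm.SameCycle.refl _ (e, true))))
        exact (G.rot_inner v (e', false) (e, true) he').2 ht
      rw [← ih e' (he'.trans ht.symm)
        (Or.inr (he.elim (fun h => h ▸ G.precedes_of_eq (ht.trans he'.symm))
          fun h => h.trans (G.precedes_of_eq (ht.trans he'.symm))))]
      refine eq_of_sameCycle (fun c hc => H.rot_of_eq_zero ?_) hc
      exact hv _ ((G.rot_inner v (e', false) _ he').1 (hc.trans (Equiv.Perm.sameCycle_apply_right.2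
        (Equiv.Perm.SameCycle.refl _ _))))

/-- A height is constant upstream of its flow. -/
theorem eq_source [NeZero N] {g : E} (h1 : ∀ e, z e ≠ 0 → G.Precedes g e)
    (h2 : ∀ j, z (G.sourceEdge j) = 0) {e : E} (he : e = g ∨ G.Precedes e g) :
    h (e, false) = h (G.sourceEdge 0, false) := by
  induction e using G.edge_induction_source with
  | _ e ih =>
    cases ht : G.src e with
    | sink i => exact absurd ht (G.src_ne_sink e i)
    | source i =>
      rw [(G.src_eq_source e _).1 ht]
      exact eq_of_comp_finRotate (fun i => h (G.sourceEdge i, false)) (fun i => by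
          rw [← G.rot_source i, H.rot_of_eq_zero]
          rw [G.rot_source]; exact h2 _) i 0
    | inner v =>
      have hv : ∀ d, G.dartVertex d = .inner v → z d.1 = 0 := by
        intro d hd
        by_contra hz
        have hdg := h1 _ hz
        have hed : G.Precedes d.1 g ∨ G.src g = G.src d.1 := by
          obtain ⟨d, _ | _⟩ := d
          · rcases he with rfl | ⟨⟨p⟩⟩
            · exact Or.inr (ht.trans hd.symm)
            · obtain ⟨q⟩ := hdg
              have h5 : G.srcPt d = G.srcPt e := hd.trans ht.symm
              have h6 := G.acyclic _ ((q.cast rfl h5).comp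
                ((Quiver.Path.nil.cons (G.arrow e)).comp (Quiver.Path.cons p (G.arrow g))))
              have h7 := congrArg Quiver.Path.length h6
              simp at h7
          · have h4 := G.precedes_of_eq (Eq.trans hd ht.symm)
            rcases he with rfl | he
            · exact Or.inl h4
            · exact Or.inl (h4.trans he)
        rcases hed with hed | hed
        · exact G.not_precedes_self _ (hed.trans hdg)
        · obtain ⟨q⟩ := hdg
          exact G.not_precedes_self g ⟨q.cast rfl hed.symm⟩
      obtain ⟨e', he'⟩ := G.exists_in v
      have h3 : h (e', true) = h (e', false) := by
        rw [H.jump, hv (e', true) he', add_zero]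
      rw [← ih e' (he'.trans ht.symm)
        (Or.inr (he.elim (fun h => h ▸ G.precedes_of_eq (he'.trans ht.symm))
          fun h => (G.precedes_of_eq (he'.trans ht.symm)).trans h)), ← h3]
      refine eq_of_sameCycle (fun c hc => H.rot_of_eq_zero ?_)
        ((G.rot_inner v (e', true) _ he').2 ht)
      exact hv _ ((G.rot_inner v (e', true) _ he').1
        (hc.trans (Equiv.Perm.sameCycle_apply_right.2 (Equiv.Perm.SameCycle.refl _ _))))

end IsHeight

theorem precedes_of_mem_left {a : G.Pt} {g e : E} (p : Quiver.Path a (G.srcPt g))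
    (h : e ∈ G.edgeList p) : G.Precedes e g := by
  obtain ⟨-, p₂, -⟩ := G.exists_eq_of_mem_edgeList p h
  exact ⟨p₂⟩

theorem precedes_of_mem_right {b : G.Pt} {g e : E} (p : Quiver.Path (G.tgtPt g) b)
    (h : e ∈ G.edgeList p) : G.Precedes g e := by
  obtain ⟨p₁, -, -⟩ := G.exists_eq_of_mem_edgeList p h
  exact ⟨p₁⟩

theorem not_precedes_of_sink (j : Fin N) (e : E) : ¬G.Precedes (G.sinkEdge j) e := by
  rintro ⟨p⟩
  have key : ∀ {a b : G.Pt} (p : Quiver.Path a b), a = G.sinkPt j → b = G.sinkPt j := by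
    intro a b p ha
    induction p with
    | nil => exact ha
    | cons p e ih => exact absurd (e.2.1.trans ih) (G.src_ne_sink _ j)
  exact G.src_ne_sink e j (key p (G.tgt_sinkEdge j))

theorem not_precedes_source (i : Fin N) (e : E) : ¬G.Precedes e (G.sourceEdge i) := by
  rintro ⟨p⟩
  have key : ∀ {a b : G.Pt} (p : Quiver.Path a b), a ≠ G.sourcePt i → b ≠ G.sourcePt i := by
    intro a b p ha
    cases p with
    | nil => exact ha
    | cons p e => exact fun h => G.tgt_ne_source _ i (e.2.2.trans h)
  exact key p (G.tgt_ne_source e i) (G.src_sourceEdge i)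

theorem flow_source_eq_zero {b : G.Pt} {g : E} (p : Quiver.Path (G.tgtPt g) b) (i : Fin N) :
    G.flow p (G.sourceEdge i) = 0 := by
  by_contra h
  exact G.not_precedes_source i g (G.precedes_of_mem_right p (G.mem_of_flow_ne_zero h))

theorem flow_sink_eq_zero {a : G.Pt} {g : E} (p : Quiver.Path a (G.srcPt g)) (i : Fin N) :
    G.flow p (G.sinkEdge i) = 0 := by
  by_contra h
  exact G.not_precedes_of_sink i g (G.precedes_of_mem_left p (G.mem_of_flow_ne_zero h))

/-- Both indices are pairings of flows with the same cut, and the cut joins the faces just above the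
first source and the first sink. -/
theorem pathIndex_sub_eq [NeZero N] {a b a' b' : G.Pt} (p : Quiver.Path a b)
    (q : Quiver.Path a' b') {h : E × Bool → ℤ}
    (H : G.IsHeight (fun e => G.flow p e - G.flow q e) h) :
    G.pathIndex p - G.pathIndex q = h (G.sinkEdge 0, false) - h (G.sourceEdge 0, false) := by
  rw [← H.sum_mul_edgeIndex]
  simp only [sub_mul, Finset.sum_sub_distrib, pathIndex, ← sum_flow_mul, Int.cast_id]

/-- The height at a common edge of two paths is the difference of the indices of the parts of the
paths before this edge. -/
theorem pathIndex_sub_eq_of_common [NeZero N] {k j i l : Fin N} {g : E}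
    (p₁ : Quiver.Path (G.sourcePt k) (G.srcPt g)) (p₂ : Quiver.Path (G.tgtPt g) (G.sinkPt j))
    (q₁ : Quiver.Path (G.sourcePt i) (G.srcPt g)) (q₂ : Quiver.Path (G.tgtPt g) (G.sinkPt l))
    {h : E × Bool → ℤ}
    (H : G.IsHeight (fun e => G.flow ((p₁.cons (G.arrow g)).comp p₂) e -
      G.flow ((q₁.cons (G.arrow g)).comp q₂) e) h) :
    G.pathIndex p₁ - G.pathIndex q₁ = h (g, false) - h (G.sourceEdge 0, false) := by
  -- The height splits at `g` as `h' + (h - h')`, the flows before and after `g`. The part `h'` has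
  -- the same value at `g` as at the sinks, where it gives the index difference; `h - h'` has the
  -- same value at `g` as at the start of the cut.
  obtain ⟨h', H'⟩ := G.exists_isHeight p₁ q₁ rfl rfl
  have H'' : G.IsHeight (fun e => G.flow p₂ e - G.flow q₂ e) (fun d => h d - h' d) := by
    convert H.sub H' using 2 with e
    simp only [flow_comp, flow_cons]
    ring
  have e1 := H'.eq_sink (g := g) (fun e he => by
    by_cases h1 : G.flow p₁ e = 0
    · exact G.precedes_of_mem_left q₁ (G.mem_of_flow_ne_zero fun h2 => he (by rw [h1, h2, sub_self]))
    · exact G.precedes_of_mem_left p₁ (G.mem_of_flow_ne_zero h1))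
    (fun j => by rw [flow_sink_eq_zero, flow_sink_eq_zero, sub_self]) (Or.inl rfl)
  have e2 := H''.eq_source (g := g) (fun e he => by
    by_cases h1 : G.flow p₂ e = 0
    · exact G.precedes_of_mem_right q₂
        (G.mem_of_flow_ne_zero fun h2 => he (by rw [h1, h2, sub_self]))
    · exact G.precedes_of_mem_right p₂ (G.mem_of_flow_ne_zero h1))
    (fun j => by rw [flow_source_eq_zero, flow_source_eq_zero, sub_self]) (Or.inl rfl)
  rw [G.pathIndex_sub_eq p₁ q₁ H']
  linarith

theorem pathIndex_sub_eq_of_common_arrow [NeZero N] {k j i l : Fin N} {x y : G.Pt} (g : x ⟶ y)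
    (p₁ : Quiver.Path (G.sourcePt k) x) (p₂ : Quiver.Path y (G.sinkPt j))
    (q₁ : Quiver.Path (G.sourcePt i) x) (q₂ : Quiver.Path y (G.sinkPt l))
    {h : E × Bool → ℤ}
    (H : G.IsHeight (fun e => G.flow ((p₁.cons g).comp p₂) e -
      G.flow ((q₁.cons g).comp q₂) e) h) :
    G.pathIndex p₁ - G.pathIndex q₁ = h (g.1, false) - h (G.sourceEdge 0, false) := by
  obtain ⟨g, rfl, rfl⟩ := g
  exact G.pathIndex_sub_eq_of_common p₁ p₂ q₁ q₂ H

end PerfectCylindricalNetwork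

/-! ## Corner contributions along a path -/

/-- A fixed point or a 2-cycle through `a` would be a smaller invariant set, so the permutation runs
through the three elements in one of the two possible orders. -/
theorem cyclic_of_sameCycle {α : Type*} {σ : Equiv.Perm α} {a b c : α} (hab : a ≠ b)
    (hac : a ≠ c) (hbc : b ≠ c) (h : ∀ d, σ.SameCycle a d ↔ d = a ∨ d = b ∨ d = c) :
    (σ a = b ∧ σ b = c ∧ σ c = a) ∨ (σ a = c ∧ σ c = b ∧ σ b = a) := by
  have hσ : ∀ d, d = a ∨ d = b ∨ d = c → σ d = a ∨ σ d = b ∨ σ d = c := fun d hd =>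
    (h _).1 (Equiv.Perm.sameCycle_apply_right.2 ((h d).2 hd))
  have inj : ∀ {x y z}, σ x = z → σ y = z → x = y := fun h1 h2 => σ.injective (h1.trans h2.symm)
  have hb := (h b).2 (Or.inr (Or.inl rfl))
  have hc := (h c).2 (Or.inr (Or.inr rfl))
  have na : σ a ≠ a := fun ha => by
    have := eq_of_sameCycle (f := fun d => d = a) (fun d _ => propext
      ⟨fun h => inj h ha, fun h => by rw [h, ha]⟩) hb
    exact hab (this.mpr rfl).symm
  have na2 : ∀ x y, x ≠ a → y ≠ a → x ≠ y → (∀ d, σ.SameCycle a d → d = a ∨ d = x ∨ d = y) →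
      σ.SameCycle a y → σ a = x → σ x ≠ a := by
    intro x y hx hy hxy hall hay h1 h2
    have := eq_of_sameCycle (f := fun d => d = a ∨ d = x) (fun d hd => propext
      ⟨fun h => h.elim (fun h => Or.inr (inj h h2)) (fun h => Or.inl (inj h h1)),
        fun h => h.elim (fun h => Or.inr (by rw [h, h1])) (fun h => Or.inl (by rw [h, h2]))⟩) hay
    exact (this.mpr (Or.inl rfl)).elim hy (fun h => hxy h.symm)
  rcases hσ a (Or.inl rfl) with ha | ha | ha
  · exact absurd ha na
  · have hb1 := na2 b c hab.symm hac.symm hbc (fun d => (h d).1) hc ha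
    have hb2 : σ b = c := by
      rcases hσ b (Or.inr (Or.inl rfl)) with h1 | h1 | h1
      · exact absurd h1 hb1
      · exact absurd (inj h1 ha).symm hab
      · exact h1
    refine Or.inl ⟨ha, hb2, ?_⟩
    rcases hσ c (Or.inr (Or.inr rfl)) with h1 | h1 | h1
    · exact h1
    · exact absurd (inj h1 ha).symm hac
    · exact absurd (inj h1 hb2).symm hbc
  · have hb1 := na2 c b hac.symm hab.symm hbc.symm
      (fun d hd => by have := (h d).1 hd; tauto) hb ha
    have hb2 : σ c = b := by
      rcases hσ c (Or.inr (Or.inr rfl)) with h1 | h1 | h1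
      · exact absurd h1 hb1
      · exact h1
      · exact absurd (inj h1 ha).symm hac
    refine Or.inr ⟨ha, hb2, ?_⟩
    rcases hσ b (Or.inr (Or.inl rfl)) with h1 | h1 | h1
    · exact h1
    · exact absurd (inj h1 hb2) hbc
    · exact absurd (inj h1 ha).symm hab

namespace PerfectCylindricalNetwork

variable {V : Type u} {E : Type v} [Fintype V] [Fintype E] {N : ℕ}
  (G : PerfectCylindricalNetwork V E N N)

theorem exists_third_dart {v : V} {a b : E × Bool} (ha : G.dartVertex a = .inner v)
    (hb : G.dartVertex b = .inner v) (hab : a ≠ b) :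
    ∃ x, a ≠ x ∧ b ≠ x ∧ (∀ d, G.dartVertex d = .inner v ↔ d = a ∨ d = b ∨ d = x) ∧
      ((G.rot a = b ∧ G.rot b = x ∧ G.rot x = a) ∨
        (G.rot a = x ∧ G.rot x = b ∧ G.rot b = a)) := by
  have hex : ∃ x, a ≠ x ∧ b ≠ x ∧ ∀ d, G.dartVertex d = .inner v ↔ d = a ∨ d = b ∨ d = x := by
    obtain ⟨x, y, z, hxy, hxz, hyz, hs⟩ := Set.ncard_eq_three.1 (G.trivalent v)
    have hs' : ∀ d, G.dartVertex d = .inner v ↔ d = x ∨ d = y ∨ d = z := fun d => by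
      have := Set.ext_iff.1 hs d
      simpa using this
    have ha' := (hs' a).1 ha
    have hb' := (hs' b).1 hb
    rcases ha' with rfl | rfl | rfl <;> rcases hb' with rfl | rfl | rfl
    · exact absurd rfl hab
    · exact ⟨z, hxz, hyz, hs'⟩
    · exact ⟨y, hxy, hyz.symm, fun d => by rw [hs']; tauto⟩
    · exact ⟨z, hyz, hxz, fun d => by rw [hs']; tauto⟩
    · exact absurd rfl hab
    · exact ⟨x, hxy.symm, hxz.symm, fun d => by rw [hs']; tauto⟩
    · exact ⟨y, hyz.symm, hxy, fun d => by rw [hs']; tauto⟩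
    · exact ⟨x, hxz.symm, hxy.symm, fun d => by rw [hs']; tauto⟩
    · exact absurd rfl hab
  obtain ⟨x, h1, h2, h3⟩ := hex
  exact ⟨x, h1, h2, h3, cyclic_of_sameCycle hab h1 h2 fun d => (G.rot_inner v a d ha).trans (h3 d)⟩

/-- Conservation of the flow of a path at an internal vertex. -/
theorem flow_conservation {k j : Fin N} (p : Quiver.Path (G.sourcePt k) (G.sinkPt j)) {v : V}
    {a b x : E × Bool} (hab : a ≠ b) (hax : a ≠ x) (hbx : b ≠ x)
    (h : ∀ d, G.dartVertex d = .inner v ↔ d = a ∨ d = b ∨ d = x) :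
    (if a.2 then G.flow p a.1 else -G.flow p a.1) + (if b.2 then G.flow p b.1 else -G.flow p b.1) +
      (if x.2 then G.flow p x.1 else -G.flow p x.1) = 0 := by
  classical
  have h1 := G.sum_flow_mul_sub (R := ℤ) p (fun w => if w = .inner v then 1 else 0)
  have h2 : (∑ e, ((G.flow p e : ℤ) : ℤ) * ((if G.tgt e = .inner v then 1 else 0) -
      (if G.src e = .inner v then 1 else 0))) =
      ∑ d, if G.dartVertex d = .inner v then (if d.2 then G.flow p d.1 else -G.flow p d.1)
        else 0 := by
    rw [Fintype.sum_prod_type]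
    refine Finset.sum_congr rfl fun e _ => ?_
    simp only [Fintype.sum_bool, RibbonNetwork.dartVertex]
    split_ifs <;> simp_all
  have h3 : (∑ d, if G.dartVertex d = .inner v then (if d.2 then G.flow p d.1 else -G.flow p d.1)
      else 0) = ∑ d ∈ ({a, b, x} : Finset (E × Bool)),
        (if d.2 then G.flow p d.1 else -G.flow p d.1) := by
    rw [← Finset.sum_filter]
    refine Finset.sum_congr ?_ fun _ _ => rfl
    ext d
    simp [h]
  rw [Finset.sum_insert (by simp [hab, hax]), Finset.sum_insert (by simp [hbx]),
    Finset.sum_singleton, ← add_assoc] at h3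
  rw [← h3, ← h2]
  refine Eq.trans ?_ (h1.trans ?_)
  · simp
  · simp [RibbonNetwork.sourcePt, RibbonNetwork.sinkPt]

theorem flow_sourceEdge {k j : Fin N} (p : Quiver.Path (G.sourcePt k) (G.sinkPt j)) (a : Fin N) :
    G.flow p (G.sourceEdge a) = if k = a then 1 else 0 := by
  classical
  have h1 := G.sum_flow_mul_sub (R := ℤ) p (fun w => if w = .source a then 1 else 0)
  simp only [G.tgt_ne_source, G.src_eq_source, RibbonNetwork.sourcePt, RibbonNetwork.sinkPt] at h1
  simp at h1
  convert h1
  rfl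

theorem flow_sinkEdge {k j : Fin N} (p : Quiver.Path (G.sourcePt k) (G.sinkPt j)) (a : Fin N) :
    G.flow p (G.sinkEdge a) = if j = a then 1 else 0 := by
  classical
  have h1 := G.sum_flow_mul_sub (R := ℤ) p (fun w => if w = .sink a then 1 else 0)
  simp only [G.src_ne_sink, G.tgt_eq_sink, RibbonNetwork.sourcePt, RibbonNetwork.sinkPt] at h1
  simp at h1
  convert h1
  rfl

/-! ### Telescoping of the corner contributions along a path -/

section Corners

variable {K : Type w} [Field K] (t : K) (h : E × Bool → ℤ)

open Classical in
/-- The contribution of a pair of darts at an internal vertex, weighted by the height of the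
corner after the second one in the counterclockwise order. -/
def cornerWeight (d d' : E × Bool) : K :=
  (if (∃ v, G.dartVertex d' = .inner v) ∧ G.rot d = d' then 1 / 2 * t ^ h d' else 0) -
    (if (∃ v, G.dartVertex d' = .inner v) ∧ G.rot d' = d then 1 / 2 * t ^ h d else 0)

/-- The sum of the contributions of the darts of a path to the corners at a dart. -/
def cornerSum {a b : G.Pt} (p : Quiver.Path a b) (d : E × Bool) : K :=
  ∑ e, (G.flow p e : K) * G.cornerWeight t h (e, d.2) d

theorem cornerSum_of_not_inner {a b : G.Pt} (p : Quiver.Path a b) {d : E × Bool}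
    (hd : ∀ v, G.dartVertex d ≠ .inner v) : G.cornerSum t h p d = 0 := by
  simp [cornerSum, cornerWeight, hd]

theorem cornerSum_eq {a b : G.Pt} (p : Quiver.Path a b) {x d y : E × Bool} {v : V}
    (hd : G.dartVertex d = .inner v) (hx : G.rot x = d) (hy : G.rot d = y) :
    G.cornerSum t h p d = (if x.2 = d.2 then (G.flow p x.1 : K) * (1 / 2 * t ^ h d) else 0) -
      (if y.2 = d.2 then (G.flow p y.1 : K) * (1 / 2 * t ^ h y) else 0) := by
  classical
  have hv : ∃ v, G.dartVertex d = .inner v := ⟨v, hd⟩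
  have e1 : ∀ e, G.rot (e, d.2) = d ↔ (e, d.2) = x := fun e => by
    rw [← hx, G.rot.injective.eq_iff]
  simp only [cornerSum, cornerWeight, hv, true_and, e1, hy, mul_sub, Finset.sum_sub_distrib]
  congr 1
  · split_ifs with h1
    · rw [Finset.sum_eq_single x.1 (fun e _ he => by
        rw [if_neg (fun h => he (by rw [← h])), mul_zero]) (by simp), if_pos (by rw [← h1])]
    · exact Finset.sum_eq_zero fun e _ => by rw [if_neg (fun h => h1 (by rw [← h])), mul_zero]
  · split_ifs with h1
    · rw [Finset.sum_eq_single y.1 (fun e _ he => by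
        rw [if_neg (fun h => he (by rw [h])), mul_zero]) (by simp), if_pos (by rw [← h1]), ← h1]
    · exact Finset.sum_eq_zero fun e _ => by rw [if_neg (fun h => h1 (by rw [h])), mul_zero]

/-- The potential of an edge. -/
def edgePotential (e : E) : K := t ^ h (e, false) + t ^ (h (e, true) + 1)

theorem flow_eq_zero_or_one {a b : G.Pt} (p : Quiver.Path a b) (e : E) :
    G.flow p e = 0 ∨ G.flow p e = 1 := by
  classical
  rw [flow_eq]
  split_ifs
  · exact Or.inr rfl
  · exact Or.inl rfl

variable {t h} (ht : t ≠ 0) (h2 : (2 : K) ≠ 0) {k j i l : Fin N}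
  (p : Quiver.Path (G.sourcePt k) (G.sinkPt j)) (q : Quiver.Path (G.sourcePt i) (G.sinkPt l))
  (H : G.IsHeight (fun e => G.flow p e - G.flow q e) h)
include ht h2 H

/-- The potential changes at an internal vertex by the contributions of its corners. -/
theorem edgePotential_sub {g g' : E} {v : V} (hg : G.tgt g = .inner v) (hg' : G.src g' = .inner v)
    (hq : G.flow q g = 1) (hq' : G.flow q g' = 1) :
    edgePotential t h g - edgePotential t h g' =
      2 * (t - 1) * (G.cornerSum t h p (g, true) + G.cornerSum t h p (g', false)) := by
  have hne : ((g, true) : E × Bool) ≠ (g', false) := by simp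
  obtain ⟨x, hx1, hx2, hv, hrot⟩ := G.exists_third_dart (a := (g, true)) (b := (g', false)) hg hg' hne
  have cp := G.flow_conservation p hne hx1 hx2 hv
  have cq := G.flow_conservation q hne hx1 hx2 hv
  obtain ⟨x, b⟩ := x
  have px := G.flow_eq_zero_or_one p x
  have pg := G.flow_eq_zero_or_one p g
  have pg' := G.flow_eq_zero_or_one p g'
  -- The path `q` enters by `g` and leaves by `g'`, so conservation leaves nothing for the third
  -- edge.
  have qx : G.flow q x = 0 := by
    cases b <;> simp only [if_true, Bool.false_eq_true, if_false] at cq <;> omega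
  have s1 : ∀ m : ℤ, t ^ (m + 1) = t ^ m * t := fun m => zpow_add_one₀ ht m
  have hd : G.dartVertex (g, true) = .inner v := hg
  have hd' : G.dartVertex (g', false) = .inner v := hg'
  have e3 := H.jump g
  have e4 := H.jump g'
  -- In the first case the third edge lies to the left of `q`, in the second to the right; the face
  -- on the other side does not change. The value of `b` tells whether that edge enters or leaves
  -- the vertex. If `p` avoids it, both sides of the identity vanish.
  rcases hrot with ⟨r1, r2, r3⟩ | ⟨r1, r2, r3⟩
  · rw [G.cornerSum_eq t h p hd r3 r1, G.cornerSum_eq t h p hd' r1 r2]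
    have e1 := H.rot_head r3
    have e2 := H.rot_tail r1
    have A : h (g', true) = h (g, true) := by omega
    have B : h (g, false) = h (x, b) := by omega
    cases b
    · have e5 := H.rot_tail r2
      simp only [if_true, Bool.false_eq_true, if_false] at cp
      have C : h (g', false) = h (x, false) + G.flow p x := by omega
      simp only [edgePotential, A, B, C, reduceCtorEq, if_false, if_true]
      rcases px with px | px
      · simp [px]
      · simp [px, s1]
        field_simp
        ring
    · have e5 := H.rot_head r2
      simp only [if_true, Bool.false_eq_true, if_false] at cp
      have C : h (x, true) = h (g', false) + G.flow p x := by omega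
      simp only [edgePotential, A, B, C, reduceCtorEq, if_false, if_true]
      rcases px with px | px
      · simp [px]
      · have D : h (g, true) = h (g', false) := by omega
        simp [px, s1, D]
        field_simp
  · rw [G.cornerSum_eq t h p hd r3 r1, G.cornerSum_eq t h p hd' r2 r3]
    have e1 := H.rot_head r3
    have e2 := H.rot_tail r2
    have A : h (g, false) = h (g', false) := by omega
    have B : h (g', true) = h (x, b) := by omega
    cases b
    · have e5 := H.rot_tail r1
      simp only [if_true, Bool.false_eq_true, if_false] at cp
      have C : h (g, true) = h (x, false) + G.flow p x := by omega
      simp only [edgePotential, A, B, C, reduceCtorEq, if_false, if_true]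
      rcases px with px | px
      · simp [px]
      · have D : h (g', false) = h (x, false) + 1 := by omega
        simp [px, s1, D]
        field_simp
    · have e5 := H.rot_head r1
      simp only [if_true, Bool.false_eq_true, if_false] at cp
      have C : h (x, true) = h (g, true) + G.flow p x := by omega
      simp only [edgePotential, A, B, C, reduceCtorEq, if_false, if_true]
      rcases px with px | px
      · simp [px]
      · simp [px, s1]
        field_simp
        ring

/-- `edgePotential_sub` pairs the head of one edge with the tail of the next. The head of the last
edge `g` is still unpaired, which accounts for the extra term; at the source there is no corner. -/
theorem sum_cornerSum_prefix {b : G.Pt} (q₁ : Quiver.Path (G.sourcePt i) b) {c : G.Pt} (g : b ⟶ c)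
    (q₂ : Quiver.Path c (G.sinkPt l)) (hq : (q₁.cons g).comp q₂ = q) :
    2 * (t - 1) * ((G.edgeList (q₁.cons g)).map fun e =>
        G.cornerSum t h p (e, true) + G.cornerSum t h p (e, false)).sum =
      edgePotential t h (G.sourceEdge i) - edgePotential t h g.1 +
        2 * (t - 1) * G.cornerSum t h p (g.1, true) := by
  induction q₁ generalizing c with
  | nil =>
    have hs : G.src g.1 = .source i := g.2.1
    have h0 : G.cornerSum t h p (g.1, false) = 0 := G.cornerSum_of_not_inner t h p fun v hv => by
      have := hs.symm.trans hv
      cases this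
    rw [(G.src_eq_source _ _).1 hs] at h0
    simp [edgeList, h0, (G.src_eq_source _ _).1 hs]
  | cons q₁ g₀ ih =>
    rename_i b
    have hmem : G.flow q g₀.1 = 1 ∧ G.flow q g.1 = 1 := by
      classical
      rw [flow_eq, flow_eq, ← hq, edgeList_comp]
      simp [edgeList]
    have hb : ∃ v, b = CylVertex.inner v := by
      cases hb : (b : CylVertex V N N) with
      | source i => exact absurd (g₀.2.2.trans hb) (G.tgt_ne_source _ i)
      | sink i => exact absurd (g.2.1.trans hb) (G.src_ne_sink _ i)
      | inner v => exact ⟨v, rfl⟩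
    obtain ⟨v, hb⟩ := hb
    have h3 := G.edgePotential_sub ht h2 p q H (g₀.2.2.trans hb) (g.2.1.trans hb) hmem.1 hmem.2
    have h4 := ih g₀ (Quiver.Path.comp g.toPath q₂) (by rw [← Quiver.Path.comp_assoc]; exact hq)
    rw [edgeList, List.map_cons, List.sum_cons, mul_add, h4]
    linear_combination -h3

theorem sum_cornerSum :
    2 * (t - 1) * ∑ e, (G.flow q e : K) *
        (G.cornerSum t h p (e, true) + G.cornerSum t h p (e, false)) =
      edgePotential t h (G.sourceEdge i) - edgePotential t h (G.sinkEdge l) := by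
  rw [sum_flow_mul]
  have key : ∀ {c : G.Pt} (q' : Quiver.Path (G.sourcePt i) c), (hc : c = G.sinkPt l) →
      q'.cast rfl hc = q → 2 * (t - 1) * ((G.edgeList q).map fun e =>
        G.cornerSum t h p (e, true) + G.cornerSum t h p (e, false)).sum =
      edgePotential t h (G.sourceEdge i) - edgePotential t h (G.sinkEdge l) := by
    intro c q' hc hq
    cases q' with
    | nil => cases hc
    | cons q₁ g =>
      subst hc
      have h3 := G.sum_cornerSum_prefix ht h2 p q H q₁ g Quiver.Path.nil hq
      have hs : G.tgt g.1 = .sink l := g.2.2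
      have h0 : G.cornerSum t h p (g.1, true) = 0 := G.cornerSum_of_not_inner t h p fun v hv => by
        have := hs.symm.trans hv
        cases this
      rw [h0, mul_zero, add_zero, (G.tgt_eq_sink _ _).1 hs] at h3
      rw [← h3, ← hq]
      rfl
  exact key q rfl rfl

-- Moving down from just above one source to just above the next crosses the source edge between
-- them, which adds 1 if `p` starts there and subtracts 1 if `q` does.
omit ht h2 in
theorem height_sourceEdge [NeZero N] (a : Fin N) :
    h (G.sourceEdge a, false) = h (G.sourceEdge 0, false) + (if k < a then 1 else 0) -
      (if i < a then 1 else 0) := by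
  obtain ⟨n, rfl⟩ := Nat.exists_eq_succ_of_ne_zero (NeZero.ne N)
  induction a using Fin.induction with
  | zero => simp
  | succ a ih =>
    have h1 := H.rot_tail (G.rot_source a.castSucc)
    rw [flow_sourceEdge, flow_sourceEdge, finRotate_apply, Fin.coeSucc_eq_succ] at h1
    rw [ih] at h1
    have e1 : ∀ k : Fin (n + 1), k < a.succ ↔ k < a.castSucc ∨ k = a.castSucc := fun k => by
      rw [Fin.lt_def, Fin.lt_def, Fin.ext_iff, Fin.val_succ, Fin.val_castSucc]; omega
    have e2 : ∀ k : Fin (n + 1), (if k < a.succ then (1 : ℤ) else 0) =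
        (if k < a.castSucc then 1 else 0) + if k = a.castSucc then 1 else 0 := fun k => by
      by_cases h : k < a.castSucc
      · simp [e1, h, h.ne]
      · simp [e1, h]
    rw [e2, e2]
    linarith

omit ht h2 in
theorem height_sinkEdge [NeZero N] (a : Fin N) :
    h (G.sinkEdge a, false) = h (G.sinkEdge 0, false) + (if j < a then 1 else 0) -
      (if l < a then 1 else 0) := by
  obtain ⟨n, rfl⟩ := Nat.exists_eq_succ_of_ne_zero (NeZero.ne N)
  induction a using Fin.induction with
  | zero => simp
  | succ a ih =>
    have h1 := H.rot_head (G.rot_sink a.castSucc)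
    rw [finRotate_apply, Fin.coeSucc_eq_succ, H.jump, H.jump, add_left_inj, ih, flow_sinkEdge,
      flow_sinkEdge] at h1
    have e1 : ∀ k : Fin (n + 1), k < a.succ ↔ k < a.castSucc ∨ k = a.castSucc := fun k => by
      rw [Fin.lt_def, Fin.lt_def, Fin.ext_iff, Fin.val_succ, Fin.val_castSucc]; omega
    have e2 : ∀ k : Fin (n + 1), (if k < a.succ then (1 : ℤ) else 0) =
        (if k < a.castSucc then 1 else 0) + if k = a.castSucc then 1 else 0 := fun k => by
      by_cases h : k < a.castSucc
      · simp [e1, h, h.ne]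
      · simp [e1, h]
    rw [e2, e2]
    linarith

end Corners

end PerfectCylindricalNetwork

/-! ## Brackets of paths as sums over pairs of edges -/

section Splits

variable {Q : Type u} [Quiver.{v} Q]

/-- A path with a distinguished arrow. -/
abbrev Split (a b : Q) : Type (max u v) :=
  Σ x y : Q, (x ⟶ y) × Quiver.Path a x × Quiver.Path y b

/-- The path underlying a path with a distinguished arrow. -/
def Split.path {a b : Q} (s : Split a b) : Quiver.Path a b :=
  (s.2.2.2.1.cons s.2.2.1).comp s.2.2.2.2

/-- Append an arrow after the distinguished one. -/
def Split.cons {a b c : Q} (s : Split a b) (f : b ⟶ c) : Split a c :=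
  ⟨s.1, s.2.1, s.2.2.1, s.2.2.2.1, s.2.2.2.2.cons f⟩

theorem Split.path_ne_nil {a : Q} (s : Split a a) : s.path ≠ Quiver.Path.nil := fun h => by
  have := congrArg Quiver.Path.length h
  simp [Split.path] at this

theorem Split.path_eq_cons {a b c : Q} (p : Quiver.Path a b) (f : b ⟶ c) (s : Split a c) :
    s.path = p.cons f ↔
      s = ⟨b, c, f, p, Quiver.Path.nil⟩ ∨ ∃ s' : Split a b, s'.path = p ∧ s'.cons f = s := by
  constructor
  · obtain ⟨x, y, e, p₁, p₂⟩ := s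
    intro h
    cases p₂ with
    | nil =>
      cases h
      exact Or.inl rfl
    | cons p₂ g =>
      cases h
      exact Or.inr ⟨⟨x, y, e, p₁, p₂⟩, rfl, rfl⟩
  · rintro (rfl | ⟨s', rfl, rfl⟩)
    · rfl
    · rfl

theorem Split.cons_injective {a b c : Q} (f : b ⟶ c) :
    Function.Injective fun s : Split a b => s.cons f := by
  rintro ⟨x, y, e, p₁, p₂⟩ ⟨x', y', e', p₁', p₂'⟩ h
  cases h
  rfl

variable [Fintype Q] [∀ a b : Q, Fintype (a ⟶ b)] [∀ a b : Q, Fintype (Quiver.Path a b)]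
  {M : Type*} [AddCommMonoid M]

open Classical in
theorem sum_split_nil {a : Q} (F : Split a a → M) :
    ∑ s with s.path = Quiver.Path.nil, F s = 0 := by
  rw [Finset.filter_false_of_mem fun s _ => s.path_ne_nil, Finset.sum_empty]

open Classical in
theorem sum_split_cons {a b c : Q} (p : Quiver.Path a b) (f : b ⟶ c) (F : Split a c → M) :
    ∑ s with s.path = p.cons f, F s =
      F ⟨b, c, f, p, Quiver.Path.nil⟩ + ∑ s : Split a b with s.path = p, F (s.cons f) := by
  have h : (Finset.univ.filter fun s : Split a c => s.path = p.cons f) =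
      insert ⟨b, c, f, p, Quiver.Path.nil⟩
        ((Finset.univ.filter fun s : Split a b => s.path = p).map
          ⟨fun s => s.cons f, Split.cons_injective f⟩) := by
    ext s
    simp [Split.path_eq_cons]
  rw [h, Finset.sum_insert, Finset.sum_map]
  · rfl
  · simp only [Finset.mem_map, Finset.mem_filter, Finset.mem_univ, true_and, not_exists, not_and]
    intro s _ h
    have h1 : (s.cons f).2.2.2.2.length = 0 := by
      have := congrArg (fun s : Split a c => s.2.2.2.2.length) h
      exact this
    simp [Split.cons] at h1

open Classical in
theorem sum_split {a b : Q} (F : Quiver.Path a b → Split a b → M) :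
    ∑ p, ∑ s with s.path = p, F p s = ∑ s, F s.path s := by
  rw [← Finset.sum_fiberwise Finset.univ Split.path]
  exact Finset.sum_congr rfl fun p _ => Finset.sum_congr rfl fun s hs => by
    rw [(Finset.mem_filter.1 hs).2]

open Classical in
theorem sum_split_pair {a b c d : Q}
    (F : Quiver.Path a b → Quiver.Path c d → Split a b → Split c d → M) :
    ∑ p, ∑ q, ∑ s with s.path = p, ∑ s' with s'.path = q, F p q s s' =
      ∑ s, ∑ s', F s.path s'.path s s' := by
  rw [← sum_split fun p s => ∑ s', F p s'.path s s']
  refine Finset.sum_congr rfl fun p _ => ?_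
  rw [Finset.sum_comm]
  exact Finset.sum_congr rfl fun s _ => sum_split fun q s' => F p q s s'

theorem sum_sigma_diagonal {ι : Type*} [Fintype ι] {A B : ι → Type*} [∀ i, Fintype (A i)]
    [∀ i, Fintype (B i)] (g : (Σ i, A i) → (Σ i, B i) → M)
    (h : ∀ s s', s.1 ≠ s'.1 → g s s' = 0) :
    ∑ s, ∑ s', g s s' = ∑ i, ∑ x : A i × B i, g ⟨i, x.1⟩ ⟨i, x.2⟩ := by
  rw [Fintype.sum_sigma]
  refine Finset.sum_congr rfl fun i _ => ?_
  rw [Fintype.sum_prod_type]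
  refine Finset.sum_congr rfl fun x _ => ?_
  rw [Fintype.sum_sigma, Finset.sum_eq_single i
    (fun j _ hj => Finset.sum_eq_zero fun y _ => h _ _ hj.symm) (by simp)]

/-- Exchange the initial parts of two paths whose distinguished arrows have the same tail. -/
theorem sum_split_swap_tail {i j k l : Q}
    (g : Split i j → Split k l → M) (g' : Split k j → Split i l → M)
    (h₀ : ∀ s s', s.1 ≠ s'.1 → g s s' = 0) (h₀' : ∀ s s', s.1 ≠ s'.1 → g' s s' = 0)
    (h : ∀ (x y y' : Q) (e : x ⟶ y) (e' : x ⟶ y') (p₁ p₂ q₁ q₂),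
      g ⟨x, y, e, p₁, p₂⟩ ⟨x, y', e', q₁, q₂⟩ = g' ⟨x, y, e, q₁, p₂⟩ ⟨x, y', e', p₁, q₂⟩) :
    ∑ s, ∑ s', g s s' = ∑ s, ∑ s', g' s s' := by
  rw [sum_sigma_diagonal g h₀, sum_sigma_diagonal g' h₀']
  refine Finset.sum_congr rfl fun x _ => ?_
  refine Fintype.sum_equiv
    ⟨fun s => (⟨s.1.1, s.1.2.1, s.2.2.2.1, s.1.2.2.2⟩, ⟨s.2.1, s.2.2.1, s.1.2.2.1, s.2.2.2.2⟩),
      fun s => (⟨s.1.1, s.1.2.1, s.2.2.2.1, s.1.2.2.2⟩, ⟨s.2.1, s.2.2.1, s.1.2.2.1, s.2.2.2.2⟩),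
      fun _ => rfl, fun _ => rfl⟩ _ _ fun s => ?_
  exact h x _ _ _ _ _ _ _ _

/-- Exchange the initial parts of two paths whose distinguished arrows have the same head. -/
theorem sum_split_swap_head {i j k l : Q}
    (g : Split i j → Split k l → M) (g' : Split k j → Split i l → M)
    (h₀ : ∀ s s', s.2.1 ≠ s'.2.1 → g s s' = 0) (h₀' : ∀ s s', s.2.1 ≠ s'.2.1 → g' s s' = 0)
    (h : ∀ (x x' y : Q) (e : x ⟶ y) (e' : x' ⟶ y) (p₁ p₂ q₁ q₂),
      g ⟨x, y, e, p₁, p₂⟩ ⟨x', y, e', q₁, q₂⟩ = g' ⟨x', y, e', q₁, p₂⟩ ⟨x, y, e, p₁, q₂⟩) :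
    ∑ s, ∑ s', g s s' = ∑ s, ∑ s', g' s s' := by
  -- The splits are regrouped with the common head as the outer index, so that the diagonal sum
  -- applies.
  let X (a b y : Q) := Σ x : Q, (x ⟶ y) × Quiver.Path a x × Quiver.Path y b
  let φ (a b : Q) : (Σ y, X a b y) ≃ Split a b :=
    ⟨fun s => ⟨s.2.1, s.1, s.2.2⟩, fun s => ⟨s.2.1, s.1, s.2.2⟩, fun _ => rfl, fun _ => rfl⟩
  have key : ∀ {a b c d : Q} (g : Split a b → Split c d → M),
      (∀ s s', s.2.1 ≠ s'.2.1 → g s s' = 0) → ∑ s, ∑ s', g s s' =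
        ∑ y, ∑ x : X a b y × X c d y, g (φ a b ⟨y, x.1⟩) (φ c d ⟨y, x.2⟩) := by
    intro a b c d g hg
    rw [← sum_sigma_diagonal (fun s s' => g (φ a b s) (φ c d s')) fun s s' hs => hg _ _ hs,
      ← Equiv.sum_comp (φ a b)]
    exact Finset.sum_congr rfl fun s _ => (Equiv.sum_comp (φ c d) _).symm
  rw [key g h₀, key g' h₀']
  refine Finset.sum_congr rfl fun y _ => ?_
  refine Fintype.sum_equiv
    ⟨fun s => (⟨s.2.1, s.2.2.1, s.2.2.2.1, s.1.2.2.2⟩, ⟨s.1.1, s.1.2.1, s.1.2.2.1, s.2.2.2.2⟩),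
      fun s => (⟨s.2.1, s.2.2.1, s.2.2.2.1, s.1.2.2.2⟩, ⟨s.1.1, s.1.2.1, s.1.2.2.1, s.2.2.2.2⟩),
      fun _ => rfl, fun _ => rfl⟩ _ _ fun s => ?_
  exact h _ _ y _ _ _ _ _ _

end Splits

/-! ### The Leibniz expansion over pairs of arrows -/

section PathBracket

variable {K : Type w} [Field K] {Q : Type u} [Quiver.{v} Q] {Q' : Type*} [Quiver Q']
  [Fintype Q] [∀ a b : Q, Fintype (a ⟶ b)] [∀ a b : Q, Fintype (Quiver.Path a b)] (eb : ArrowBracket K Q') (F : Q ⥤q Q')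

/-- The contribution of two distinguished arrows to the bracket of two paths, for a tensor `t` at
the ends of these arrows. -/
def splitMap {a b c d : Q} (s : Split a b) (s' : Split c d) :
    Mor K (F.obj s'.1) (F.obj s.2.1) ⊗[K] Mor K (F.obj s.1) (F.obj s'.2.1) →ₗ[K]
      Mor K (F.obj c) (F.obj b) ⊗[K] Mor K (F.obj a) (F.obj d) :=
  TensorProduct.map
    (rmul K _ (ofPath K (F.mapPath s.2.2.2.2)) ∘ₗ lmul K _ (ofPath K (F.mapPath s'.2.2.2.1)))
    (rmul K _ (ofPath K (F.mapPath s'.2.2.2.2)) ∘ₗ lmul K _ (ofPath K (F.mapPath s.2.2.2.1)))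

open Classical in
theorem arrowPathBr_mapPath {x y : Q'} (e : x ⟶ y) {c d : Q} (q : Quiver.Path c d) :
    arrowPathBr eb e (F.mapPath q) = ∑ s : Split c d with s.path = q,
      TensorProduct.map (lmul K _ (ofPath K (F.mapPath s.2.2.2.1)))
        (rmul K _ (ofPath K (F.mapPath s.2.2.2.2))) (eb e (F.map s.2.2.1)) := by
  induction q with
  | nil => rw [sum_split_nil]; rfl
  | cons q f ih =>
    rw [sum_split_cons, Prefunctor.mapPath_cons, arrowPathBr, ih, map_sum]
    congr 1
    · simp [rmul_nil]
    · refine Finset.sum_congr rfl fun s _ => ?_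
      rw [← LinearMap.comp_apply, ← TensorProduct.map_comp, ← rmul_comp, LinearMap.id_comp]
      rfl

-- Unrolling both Leibniz identities gives one term for each arrow of `p` and each arrow of `q`. The
-- functor `F` will be the gluing map: paths are summed on the cylinder, where they are finite in
-- number, while the bracket lives on the torus.
open Classical in
theorem pathBr_mapPath {a b c d : Q} (p : Quiver.Path a b) (q : Quiver.Path c d) :
    pathBr eb (F.mapPath p) (F.mapPath q) = ∑ s : Split a b with s.path = p,
      ∑ s' : Split c d with s'.path = q,
        splitMap F s s' (eb (F.map s.2.2.1) (F.map s'.2.2.1)) := by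
  induction p with
  | nil => rw [sum_split_nil]; rfl
  | cons p f ih =>
    rw [sum_split_cons, Prefunctor.mapPath_cons, pathBr, ih, map_sum, arrowPathBr_mapPath, map_sum]
    congr 1
    · refine Finset.sum_congr rfl fun s _ => ?_
      rw [← LinearMap.comp_apply, ← TensorProduct.map_comp, LinearMap.id_comp, splitMap,
        lmul_rmul]
      simp [rmul_nil]
    · refine Finset.sum_congr rfl fun s _ => ?_
      rw [map_sum]
      refine Finset.sum_congr rfl fun s' _ => ?_
      rw [← LinearMap.comp_apply, splitMap, ← TensorProduct.map_comp, LinearMap.id_comp,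
        ← LinearMap.comp_assoc, ← rmul_comp]
      rfl

end PathBracket

/-! ## The bracket of boundary measurements -/

namespace PerfectCylindricalNetwork

variable {V : Type u} {E : Type v} [Fintype V] [Fintype E] {N : ℕ}
  (G : PerfectCylindricalNetwork V E N N)

instance finite_pt : Finite G.Pt :=
  Finite.of_injective
    (fun a : CylVertex V N N => match a with
      | .source i => (Sum.inl i : Fin N ⊕ V ⊕ Fin N)
      | .inner v => Sum.inr (Sum.inl v)
      | .sink j => Sum.inr (Sum.inr j))
    (by rintro (_ | _ | _) (_ | _ | _) h <;> simp at h <;> rw [h])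

instance fintype_pt : Fintype G.Pt := Fintype.ofFinite _

instance finite_hom (a b : G.Pt) : Finite (a ⟶ b) :=
  inferInstanceAs (Finite {e : E // G.src e = a ∧ G.tgt e = b})

instance fintype_hom (a b : G.Pt) : Fintype (a ⟶ b) := Fintype.ofFinite _

/-! ### Corner coefficients and heights -/

section Weights

variable {K : Type w} [Field K]

open Classical in
theorem sum_split_edge {a b : G.Pt} (p : Quiver.Path a b) (φ : E → K) :
    ∑ s : Split a b with s.path = p, φ s.2.2.1.1 = ∑ e, (G.flow p e : K) * φ e := by
  rw [sum_flow_mul]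
  induction p with
  | nil => rw [sum_split_nil]; rfl
  | cons p f ih =>
    rw [sum_split_cons, edgeList, List.map_cons, List.sum_cons, ← ih]
    rfl

theorem dartVertex_of_rot_inner {d : E × Bool} {v : V} (h : G.dartVertex (G.rot d) = .inner v) :
    G.dartVertex d = .inner v :=
  (G.rot_inner v _ _ h).1 (Equiv.Perm.sameCycle_apply_left.2 (Equiv.Perm.SameCycle.refl _ _))

theorem cornerCoeff_eq_zero {d d' : E × Bool} (h : G.dartVertex d ≠ G.dartVertex d') :
    G.cornerCoeff K d d' = 0 := by
  have h1 : ∀ {d d'}, (∃ v, G.dartVertex d = .inner v) ∧ G.rot d = d' →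
      G.dartVertex d = G.dartVertex d' := by
    rintro d _ ⟨⟨v, hv⟩, rfl⟩
    rw [hv, G.dartVertex_rot_inner hv]
  rw [cornerCoeff, if_neg fun h2 => h (h1 h2), if_neg fun h2 => h (h1 h2).symm, sub_zero]

variable (t : K) {h : E × Bool → ℤ}

theorem cornerWeight_eq_zero {d d' : E × Bool} (hd : G.dartVertex d ≠ G.dartVertex d') :
    G.cornerWeight t h d d' = 0 := by
  rw [cornerWeight, if_neg, if_neg, sub_zero]
  · rintro ⟨⟨v, hv⟩, rfl⟩
    exact hd (by rw [hv, G.dartVertex_rot_inner hv])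
  · rintro ⟨⟨v, hv⟩, rfl⟩
    exact hd (by rw [hv, G.dartVertex_of_rot_inner hv])

/-- In either cyclic order the corner used by `cornerWeight` is the one immediately before the third
dart `x`, so its height is the only one needed. -/
theorem cornerWeight_eq {d d' : E × Bool} {m : ℤ}
    (hm : ∀ v x, G.dartVertex d = .inner v → G.dartVertex d' = .inner v →
      G.dartVertex x = .inner v → (∀ c, G.dartVertex c = .inner v → c = d ∨ c = d' ∨ c = x) →
      (G.rot d' = x → h d' = m) ∧ (G.rot d = x → h d = m)) :
    G.cornerWeight t h d d' = G.cornerCoeff K d d' * t ^ m := by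
  by_cases hv : G.dartVertex d = G.dartVertex d'
  swap
  · rw [G.cornerWeight_eq_zero t hv, G.cornerCoeff_eq_zero hv, zero_mul]
  by_cases hdd : d = d'
  · subst hdd
    simp [cornerWeight, cornerCoeff]
  by_cases hi : ∃ v, G.dartVertex d' = .inner v
  swap
  · simp [cornerWeight, cornerCoeff, hv, hi]
  obtain ⟨v, hd'⟩ := hi
  have hd := hv.trans hd'
  obtain ⟨x, h1, h2, h3, h4⟩ := G.exists_third_dart hd hd' hdd
  obtain ⟨m1, m2⟩ := hm v x hd hd' ((h3 x).2 (Or.inr (Or.inr rfl))) fun c => (h3 c).1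
  have i1 : ∃ v, G.dartVertex d = .inner v := ⟨v, hd⟩
  have i2 : ∃ v, G.dartVertex d' = .inner v := ⟨v, hd'⟩
  rcases h4 with ⟨r1, r2, -⟩ | ⟨r1, -, r3⟩
  · have n1 : G.rot d' ≠ d := fun h => h1 (h.symm.trans r2)
    simp [cornerWeight, cornerCoeff, i1, r1, n1, m1 r2, hd']
  · have n1 : G.rot d ≠ d' := fun h => h2 (h.symm.trans r1)
    simp [cornerWeight, cornerCoeff, i2, r3, n1, m2 r1]

theorem flow_cons_comp {a b x y : G.Pt} (p : Quiver.Path a x) (f : x ⟶ y) (q : Quiver.Path y b) :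
    G.flow ((p.cons f).comp q) f.1 = 1 := by
  classical
  rw [flow_eq, edgeList_comp]
  simp [edgeList]

variable {G} in
/-- At an arrow common to both paths, the heights on both sides agree. -/
theorem IsHeight.eq_of_common {a b a' b' x y : G.Pt} {p : Quiver.Path a x} {f : x ⟶ y}
    {p' : Quiver.Path y b} {q : Quiver.Path a' x} {q' : Quiver.Path y b'}
    (H : G.IsHeight (fun e => G.flow ((p.cons f).comp p') e - G.flow ((q.cons f).comp q') e) h) :
    (∀ d, G.rot d = (f.1, true) → h d = h (f.1, false)) ∧
      ∀ d, G.rot d = (f.1, false) → h d = h (f.1, false) := by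
  have h1 := H.jump f.1
  refine ⟨fun d hd => ?_, fun d hd => ?_⟩
  · have h2 := H.rot_head hd
    rw [flow_cons_comp, flow_cons_comp] at h1 h2
    omega
  · have h2 := H.rot_tail hd
    rw [flow_cons_comp, flow_cons_comp] at h2
    omega

section Heights

variable [NeZero N] {k j i l : Fin N} (h₀ : h (G.sourceEdge 0, false) = 0)
include h₀

/-- At an internal vertex the third dart must be an incoming edge, by which both paths arrive. Being
common to the two paths, it has the index difference as its height, and it contributes equally to
the two indices. -/
theorem cornerWeight_tail {x y y' : G.Pt} (e : x ⟶ y) (e' : x ⟶ y')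
    (p₁ : Quiver.Path (G.sourcePt k) x) (p₂ : Quiver.Path y (G.sinkPt j))
    (q₁ : Quiver.Path (G.sourcePt i) x) (q₂ : Quiver.Path y' (G.sinkPt l))
    (H : G.IsHeight (fun a => G.flow ((p₁.cons e).comp p₂) a - G.flow ((q₁.cons e').comp q₂) a) h) :
    G.cornerWeight t h (e.1, false) (e'.1, false) =
      G.cornerCoeff K (e.1, false) (e'.1, false) * t ^ (G.pathIndex p₁ - G.pathIndex q₁) := by
  refine G.cornerWeight_eq t fun v z hd hd' hz hall => ?_
  have hx : x = CylVertex.inner v := e.2.1.symm.trans hd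
  cases p₁ with
  | nil => cases hx
  | cons p₁ f =>
    cases q₁ with
    | nil => cases hx
    | cons q₁ f' =>
      have hf : ∀ {b : G.Pt} (f : b ⟶ x), z = (f.1, true) := fun f => by
        have := hall (f.1, true) (f.2.2.trans hx)
        simpa [eq_comm] using this
      have hff : f.1 = f'.1 := congrArg Prod.fst ((hf f).symm.trans (hf f'))
      rename_i b b'
      obtain rfl : b = b' := f.2.1.symm.trans ((congrArg G.src hff).trans f'.2.1)
      obtain rfl : f = f' := Subtype.ext hff
      have hP : ((p₁.cons f).cons e).comp p₂ = (p₁.cons f).comp (e.toPath.comp p₂) := by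
        rw [← Quiver.Path.comp_assoc]; rfl
      have hQ : ((q₁.cons f).cons e').comp q₂ = (q₁.cons f).comp (e'.toPath.comp q₂) := by
        rw [← Quiver.Path.comp_assoc]; rfl
      rw [hP, hQ] at H
      have h1 := G.pathIndex_sub_eq_of_common_arrow f p₁ (e.toPath.comp p₂) q₁
        (e'.toPath.comp q₂) H
      rw [h₀, sub_zero] at h1
      rw [pathIndex_cons, pathIndex_cons, add_sub_add_right_eq_sub, h1]
      exact ⟨fun hr => H.eq_of_common.1 _ (hr.trans (hf f)),
        fun hr => H.eq_of_common.1 _ (hr.trans (hf f))⟩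

/-- Dually, the third dart is the outgoing edge by which both paths continue. The parts before it
include the distinguished arrows, hence the indices of `p₁.cons e` and `q₁.cons e'`. -/
theorem cornerWeight_head {x x' y : G.Pt} (e : x ⟶ y) (e' : x' ⟶ y)
    (p₁ : Quiver.Path (G.sourcePt k) x) (p₂ : Quiver.Path y (G.sinkPt j))
    (q₁ : Quiver.Path (G.sourcePt i) x') (q₂ : Quiver.Path y (G.sinkPt l))
    (H : G.IsHeight (fun a => G.flow ((p₁.cons e).comp p₂) a - G.flow ((q₁.cons e').comp q₂) a) h) :
    G.cornerWeight t h (e.1, true) (e'.1, true) =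
      G.cornerCoeff K (e.1, true) (e'.1, true) *
        t ^ (G.pathIndex (p₁.cons e) - G.pathIndex (q₁.cons e')) := by
  refine G.cornerWeight_eq t fun v z hd hd' hz hall => ?_
  have hy : y = CylVertex.inner v := e.2.2.symm.trans hd
  have hlen : ∀ {a : Fin N} (r : Quiver.Path y (G.sinkPt a)), r.length ≠ 0 := fun r hr => by
    have := r.eq_of_length_zero hr
    rw [hy] at this
    cases this
  obtain ⟨c, f, p₂, rfl, -⟩ := p₂.length_ne_zero_iff_eq_comp.1 (hlen p₂)
  obtain ⟨c', f', q₂, rfl, -⟩ := q₂.length_ne_zero_iff_eq_comp.1 (hlen q₂)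
  have hf : ∀ {b : G.Pt} (f : y ⟶ b), z = (f.1, false) := fun f => by
    have := hall (f.1, false) (f.2.1.trans hy)
    simpa [eq_comm] using this
  have hff : f.1 = f'.1 := congrArg Prod.fst ((hf f).symm.trans (hf f'))
  obtain rfl : c = c' := f.2.2.symm.trans ((congrArg G.tgt hff).trans f'.2.2)
  obtain rfl : f = f' := Subtype.ext hff
  have hP : (p₁.cons e).comp (f.toPath.comp p₂) = ((p₁.cons e).cons f).comp p₂ := by
    rw [← Quiver.Path.comp_assoc]; rfl
  have hQ : (q₁.cons e').comp (f.toPath.comp q₂) = ((q₁.cons e').cons f).comp q₂ := by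
    rw [← Quiver.Path.comp_assoc]; rfl
  rw [hP, hQ] at H
  have h1 := G.pathIndex_sub_eq_of_common_arrow f (p₁.cons e) p₂ (q₁.cons e') q₂ H
  rw [h₀, sub_zero] at h1
  rw [h1]
  exact ⟨fun hr => H.eq_of_common.2 _ (hr.trans (hf f)),
    fun hr => H.eq_of_common.2 _ (hr.trans (hf f))⟩

end Heights

end Weights

end PerfectCylindricalNetwork

/-! ### The `r`-matrix formula -/

namespace PerfectCylindricalNetwork

variable {V : Type u} {E : Type v} [Fintype V] [Fintype E] {N : ℕ}
  (G : PerfectCylindricalNetwork V E N N) {K : Type w} [Field K]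

/-- The coefficient with which a pair of distinguished arrows of two paths contributes to the
bracket. -/
def splitWeight (t : K) {a b c d : G.Pt} (s : Split a b) (s' : Split c d) : K :=
  G.cornerCoeff K (s.2.2.1.1, false) (s'.2.2.1.1, false) *
      t ^ (G.pathIndex s.2.2.2.1 - G.pathIndex s'.2.2.2.1) +
    G.cornerCoeff K (s.2.2.1.1, true) (s'.2.2.1.1, true) *
      t ^ (G.pathIndex (s.2.2.2.1.cons s.2.2.1) - G.pathIndex (s'.2.2.2.1.cons s'.2.2.1))

-- For fixed `p` and `q` the exponents become values of one height function, and the sum is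
-- evaluated by `sum_cornerSum` from the potentials at the two ends of `q`.
open Classical in
theorem sum_splitWeight [NeZero N] (h2 : (2 : K) ≠ 0) {x y : K} (hx : x ≠ 0) (hy : y ≠ 0)
    (hxy : x ≠ y) {k j i l : Fin N} (p : Quiver.Path (G.sourcePt k) (G.sinkPt j))
    (q : Quiver.Path (G.sourcePt i) (G.sinkPt l)) :
    ∑ s : Split (G.sourcePt k) (G.sinkPt j) with s.path = p,
      ∑ s' : Split (G.sourcePt i) (G.sinkPt l) with s'.path = q, G.splitWeight (y / x) s s' =
      trigRho N x y i k - (y / x) ^ (G.pathIndex p - G.pathIndex q) * trigRho N x y l j := by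
  set t := y / x with ht_def
  have ht : t ≠ 0 := div_ne_zero hy hx
  have hyx : y - x ≠ 0 := sub_ne_zero.2 hxy.symm
  have ht1 : t - 1 ≠ 0 := by
    rw [ht_def, div_sub_one hx]
    exact div_ne_zero hyx hx
  obtain ⟨h', H'⟩ := G.exists_isHeight p q rfl rfl
  -- Heights are unique only up to a constant. This one vanishes where the cut starts, so that
  -- heights at common edges are the index differences themselves.
  obtain ⟨h, H, h₀⟩ : ∃ h, G.IsHeight (fun e => G.flow p e - G.flow q e) h ∧
      h (G.sourceEdge 0, false) = 0 :=
    ⟨fun d => h' d - h' (G.sourceEdge 0, false),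
      ⟨fun d => congrArg (· - _) (H'.face d), fun e => by rw [H'.jump]; ring⟩, sub_self _⟩
  have e1 : ∑ s : Split (G.sourcePt k) (G.sinkPt j) with s.path = p,
      ∑ s' : Split (G.sourcePt i) (G.sinkPt l) with s'.path = q, G.splitWeight t s s' =
      ∑ s : Split (G.sourcePt k) (G.sinkPt j) with s.path = p,
        ∑ s' : Split (G.sourcePt i) (G.sinkPt l) with s'.path = q,
          (G.cornerWeight t h (s.2.2.1.1, false) (s'.2.2.1.1, false) +
            G.cornerWeight t h (s.2.2.1.1, true) (s'.2.2.1.1, true)) := by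
    refine Finset.sum_congr rfl fun s hs => Finset.sum_congr rfl fun s' hs' => ?_
    obtain ⟨x, y, e, p₁, p₂⟩ := s
    obtain ⟨x', y', e', q₁, q₂⟩ := s'
    obtain rfl := (Finset.mem_filter.1 hs).2
    obtain rfl := (Finset.mem_filter.1 hs').2
    rw [splitWeight]
    congr 1
    · by_cases hxx : x = x'
      · subst hxx
        exact (G.cornerWeight_tail t h₀ e e' p₁ p₂ q₁ q₂ H).symm
      · have hne : G.dartVertex (e.1, false) ≠ G.dartVertex (e'.1, false) :=
          fun h => hxx (e.2.1.symm.trans (Eq.trans h e'.2.1))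
        rw [G.cornerWeight_eq_zero t hne, G.cornerCoeff_eq_zero hne, zero_mul]
    · by_cases hyy : y = y'
      · subst hyy
        exact (G.cornerWeight_head t h₀ e e' p₁ p₂ q₁ q₂ H).symm
      · have hne : G.dartVertex (e.1, true) ≠ G.dartVertex (e'.1, true) :=
          fun h => hyy (e.2.2.symm.trans (Eq.trans h e'.2.2))
        rw [G.cornerWeight_eq_zero t hne, G.cornerCoeff_eq_zero hne, zero_mul]
  have e2 : ∑ s : Split (G.sourcePt k) (G.sinkPt j) with s.path = p,
      ∑ s' : Split (G.sourcePt i) (G.sinkPt l) with s'.path = q, G.splitWeight t s s' =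
      ∑ e, (G.flow q e : K) * (G.cornerSum t h p (e, true) + G.cornerSum t h p (e, false)) := by
    rw [e1, Finset.sum_comm, ← G.sum_split_edge q
      (fun e => G.cornerSum t h p (e, true) + G.cornerSum t h p (e, false))]
    refine Finset.sum_congr rfl fun s' _ => ?_
    rw [Finset.sum_add_distrib, add_comm,
      G.sum_split_edge p (fun e => G.cornerWeight t h (e, false) (s'.2.2.1.1, false)),
      G.sum_split_edge p (fun e => G.cornerWeight t h (e, true) (s'.2.2.1.1, true))]
    rfl
  have e3 := G.sum_cornerSum ht h2 p q H
  -- The left side is 2, 1 + t or 2t according to a < b, a = b or a > b: the three branches of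
  -- `trigRho` cleared of their denominator.
  have key : ∀ a b : Fin N, t ^ (if b < a then (1 : ℤ) else 0) +
      t ^ ((if b < a then (1 : ℤ) else 0) + if b = a then 1 else 0) =
        2 * (t - 1) * trigRho N x y a b := by
    intro a b
    rw [trigRho_eq, ht_def]
    rcases lt_trichotomy a b with hab | hab | hab
    · simp only [hab.not_gt, hab.ne, hab.ne', hab, if_true, if_false]
      simp
      field_simp
      ring
    · simp only [hab, lt_irrefl, if_true, if_false]
      simp
      field_simp
      ring
    · simp only [hab.not_gt, hab.ne, hab.ne', hab, if_true, if_false]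
      simp
      field_simp
      ring
  have e4 : edgePotential t h (G.sourceEdge i) = 2 * (t - 1) * trigRho N x y i k := by
    rw [← key, edgePotential, H.jump, flow_sourceEdge, flow_sourceEdge,
      G.height_sourceEdge p q H, h₀]
    simp only [lt_irrefl, if_true, if_false, zero_add, sub_zero]
    congr 2
    ring
  have e5 : edgePotential t h (G.sinkEdge l) =
      t ^ (G.pathIndex p - G.pathIndex q) * (2 * (t - 1) * trigRho N x y l j) := by
    rw [← key, edgePotential, H.jump, flow_sinkEdge, flow_sinkEdge,
      G.height_sinkEdge p q H, G.pathIndex_sub_eq p q H, h₀, mul_add, ← zpow_add₀ ht,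
      ← zpow_add₀ ht]
    simp only [lt_irrefl, if_true, if_false, sub_zero]
    congr 2
    ring
  rw [e2]
  rw [e4, e5] at e3
  refine mul_left_cancel₀ (mul_ne_zero h2 ht1) ?_
  rw [e3]
  ring

open Classical in
/-- The contribution of a common tail to the bracket of two edges. -/
def tailBracket (K : Type w) [Field K] : ArrowBracket K G.Torus := fun a b c d e h =>
  if H : a = c then
    G.cornerCoeff K (e.1, false) (h.1, false) •
      (ofPath K (Quiver.Hom.toPath (⟨e.1, e.2.1.trans H, e.2.2⟩ : c ⟶ b)) ⊗ₜ[K]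
        ofPath K (Quiver.Hom.toPath (⟨h.1, h.2.1.trans H.symm, h.2.2⟩ : a ⟶ d)))
  else 0

open Classical in
/-- The contribution of a common head to the bracket of two edges, with the opposite sign. -/
def headBracket (K : Type w) [Field K] : ArrowBracket K G.Torus := fun a b c d e h =>
  if H : b = d then
    G.cornerCoeff K (e.1, true) (h.1, true) •
      (ofPath K (Quiver.Hom.toPath (⟨h.1, h.2.1, h.2.2.trans H.symm⟩ : c ⟶ b)) ⊗ₜ[K]
        ofPath K (Quiver.Hom.toPath (⟨e.1, e.2.1, e.2.2.trans H⟩ : a ⟶ d)))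
  else 0

theorem splitMap_tailBracket {a b c d x y y' : G.Pt} (e : x ⟶ y) (e' : x ⟶ y')
    (p₁ : Quiver.Path a x) (p₂ : Quiver.Path y b) (q₁ : Quiver.Path c x) (q₂ : Quiver.Path y' d) :
    splitMap (K := K) G.gluing ⟨x, y, e, p₁, p₂⟩ ⟨x, y', e', q₁, q₂⟩
        (G.tailBracket K (G.gluing.map e) (G.gluing.map e')) =
      G.cornerCoeff K (e.1, false) (e'.1, false) •
        (ofPath K (G.gluing.mapPath ((q₁.cons e).comp p₂)) ⊗ₜ[K]
          ofPath K (G.gluing.mapPath ((p₁.cons e').comp q₂))) := by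
  have h1 : G.tailBracket K (G.gluing.map e) (G.gluing.map e') =
      G.cornerCoeff K (e.1, false) (e'.1, false) •
        (ofPath K (G.gluing.map e).toPath ⊗ₜ[K] ofPath K (G.gluing.map e').toPath) :=
    dif_pos rfl
  rw [h1, map_smul, splitMap, TensorProduct.map_tmul]
  simp [Prefunctor.mapPath_comp]

theorem splitMap_headBracket {a b c d x x' y : G.Pt} (e : x ⟶ y) (e' : x' ⟶ y)
    (p₁ : Quiver.Path a x) (p₂ : Quiver.Path y b) (q₁ : Quiver.Path c x') (q₂ : Quiver.Path y d) :
    splitMap (K := K) G.gluing ⟨x, y, e, p₁, p₂⟩ ⟨x', y, e', q₁, q₂⟩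
        (G.headBracket K (G.gluing.map e) (G.gluing.map e')) =
      G.cornerCoeff K (e.1, true) (e'.1, true) •
        (ofPath K (G.gluing.mapPath ((q₁.cons e').comp p₂)) ⊗ₜ[K]
          ofPath K (G.gluing.mapPath ((p₁.cons e).comp q₂))) := by
  have h1 : G.headBracket K (G.gluing.map e) (G.gluing.map e') =
      G.cornerCoeff K (e.1, true) (e'.1, true) •
        (ofPath K (G.gluing.map e').toPath ⊗ₜ[K] ofPath K (G.gluing.map e).toPath) :=
    dif_pos rfl
  rw [h1, map_smul, splitMap, TensorProduct.map_tmul]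
  simp [Prefunctor.mapPath_comp]

theorem tailBracket_eq_zero {x y x' y' : G.Pt} (e : x ⟶ y) (e' : x' ⟶ y') (h : x ≠ x') :
    G.tailBracket K (G.gluing.map e) (G.gluing.map e') = 0 := by
  have hc : G.cornerCoeff K (e.1, false) (e'.1, false) = 0 :=
    G.cornerCoeff_eq_zero fun h' => h (e.2.1.symm.trans (Eq.trans h' e'.2.1))
  rw [tailBracket]
  split_ifs
  · exact (congrArg (· • _) hc).trans (zero_smul K _)
  · rfl

theorem headBracket_eq_zero {x y x' y' : G.Pt} (e : x ⟶ y) (e' : x' ⟶ y') (h : y ≠ y') :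
    G.headBracket K (G.gluing.map e) (G.gluing.map e') = 0 := by
  have hc : G.cornerCoeff K (e.1, true) (e'.1, true) = 0 :=
    G.cornerCoeff_eq_zero fun h' => h (e.2.2.symm.trans (Eq.trans h' e'.2.2))
  rw [headBracket]
  split_ifs
  · exact (congrArg (· • _) hc).trans (zero_smul K _)
  · rfl

theorem boundaryMeasurement_eq (z : K) (i j : Fin N) :
    G.boundaryMeasurement K z i j =
      ∑ p : Quiver.Path (G.sourcePt i) (G.sinkPt j), z ^ G.pathIndex p • ofPath K (G.gluePath p) := by
  simp [boundaryMeasurement, cylinderMeasurement]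

/-- Exchanging the initial parts keeps each marked arrow with its final part. The original powers of
x and y, rewritten through the indices of the new paths, differ by y/x to the index difference of
the initial parts. -/
theorem sum_tailBracket {x y : K} (hx : x ≠ 0) (hy : y ≠ 0) (i j k l : Fin N) :
    ∑ s : Split (G.sourcePt i) (G.sinkPt j), ∑ s' : Split (G.sourcePt k) (G.sinkPt l),
      (x ^ G.pathIndex s.path * y ^ G.pathIndex s'.path) • splitMap (K := K) G.gluing s s'
        (G.tailBracket K (G.gluing.map s.2.2.1) (G.gluing.map s'.2.2.1)) =
    ∑ s : Split (G.sourcePt k) (G.sinkPt j), ∑ s' : Split (G.sourcePt i) (G.sinkPt l),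
      (x ^ G.pathIndex s.path * y ^ G.pathIndex s'.path *
        (G.cornerCoeff K (s.2.2.1.1, false) (s'.2.2.1.1, false) *
          (y / x) ^ (G.pathIndex s.2.2.2.1 - G.pathIndex s'.2.2.2.1))) •
        (ofPath K (G.gluing.mapPath s.path) ⊗ₜ[K] ofPath K (G.gluing.mapPath s'.path)) := by
  refine sum_split_swap_tail _ _ (fun s s' h => ?_) (fun s s' h => ?_) ?_
  · rw [G.tailBracket_eq_zero _ _ h, map_zero, smul_zero]
  · rw [G.cornerCoeff_eq_zero (d := (s.2.2.1.1, false)) (d' := (s'.2.2.1.1, false)) fun h' =>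
      h (s.2.2.1.2.1.symm.trans (Eq.trans h' s'.2.2.1.2.1)), zero_mul, mul_zero, zero_smul]
  · intro v w w' e e' p₁ p₂ q₁ q₂
    rw [splitMap_tailBracket, smul_smul]
    congr 1
    simp only [Split.path, pathIndex_comp, pathIndex_cons, zpow_add₀ hx, zpow_add₀ hy, div_zpow,
      zpow_sub₀ hx, zpow_sub₀ hy]
    field_simp

/-- Here the marked arrows travel with the initial parts, so their order in the coefficient is
reversed. Skew-symmetry produces the minus sign, which cancels the sign of the head term in
`edgeBracket`. -/
theorem sum_headBracket {x y : K} (hx : x ≠ 0) (hy : y ≠ 0) (i j k l : Fin N) :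
    ∑ s : Split (G.sourcePt i) (G.sinkPt j), ∑ s' : Split (G.sourcePt k) (G.sinkPt l),
      (x ^ G.pathIndex s.path * y ^ G.pathIndex s'.path) • splitMap (K := K) G.gluing s s'
        (G.headBracket K (G.gluing.map s.2.2.1) (G.gluing.map s'.2.2.1)) =
    -∑ s : Split (G.sourcePt k) (G.sinkPt j), ∑ s' : Split (G.sourcePt i) (G.sinkPt l),
      (x ^ G.pathIndex s.path * y ^ G.pathIndex s'.path *
        (G.cornerCoeff K (s.2.2.1.1, true) (s'.2.2.1.1, true) *
          (y / x) ^ (G.pathIndex (s.2.2.2.1.cons s.2.2.1) -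
            G.pathIndex (s'.2.2.2.1.cons s'.2.2.1)))) •
        (ofPath K (G.gluing.mapPath s.path) ⊗ₜ[K] ofPath K (G.gluing.mapPath s'.path)) := by
  simp only [← Finset.sum_neg_distrib]
  refine sum_split_swap_head _ _ (fun s s' h => ?_) (fun s s' h => ?_) ?_
  · rw [G.headBracket_eq_zero _ _ h, map_zero, smul_zero]
  · rw [G.cornerCoeff_eq_zero (d := (s.2.2.1.1, true)) (d' := (s'.2.2.1.1, true)) fun h' =>
      h (s.2.2.1.2.2.symm.trans (Eq.trans h' s'.2.2.1.2.2)), zero_mul, mul_zero, zero_smul,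
      neg_zero]
  · intro v v' w e e' p₁ p₂ q₁ q₂
    rw [splitMap_headBracket, smul_smul, ← neg_smul]
    congr 1
    rw [G.cornerCoeff_swap]
    simp only [Split.path, pathIndex_comp, pathIndex_cons, zpow_add₀ hx, zpow_add₀ hy, div_zpow,
      zpow_sub₀ hx, zpow_sub₀ hy]
    field_simp

/-- The `r`-matrix form of the double bracket of the boundary measurements. -/
theorem br_boundaryMeasurement [NeZero N] (h2 : (2 : K) ≠ 0) {x y : K} (hx : x ≠ 0) (hy : y ≠ 0)
    (hxy : x ≠ y) (i j k l : Fin N) :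
    (G.doubleBracket K).br (G.marked i) (G.marked j) (G.marked k) (G.marked l)
        (G.boundaryMeasurement K x i j) (G.boundaryMeasurement K y k l) =
      trigRho N x y i k •
          (G.boundaryMeasurement K x k j ⊗ₜ[K] G.boundaryMeasurement K y i l) -
        trigRho N x y l j •
          (G.boundaryMeasurement K y k j ⊗ₜ[K] G.boundaryMeasurement K x i l) := by
  classical
  have hbr : ∀ (p : Quiver.Path (G.sourcePt i) (G.sinkPt j))
      (q : Quiver.Path (G.sourcePt k) (G.sinkPt l)),
      (G.doubleBracket K).br (G.marked i) (G.marked j) (G.marked k) (G.marked l)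
        (ofPath K (G.gluePath p)) (ofPath K (G.gluePath q)) =
      ∑ s : Split (G.sourcePt i) (G.sinkPt j) with s.path = p,
        ∑ s' : Split (G.sourcePt k) (G.sinkPt l) with s'.path = q,
          splitMap (K := K) G.gluing s s'
            (G.edgeBracket K (G.gluing.map s.2.2.1) (G.gluing.map s'.2.2.1)) := by
    intro p q
    rw [← pathBr_mapPath]
    show linBr (G.edgeBracket K) _ _ _ _ _ _ = _
    rw [linBr, Mor.lift_ofPath, Mor.lift_ofPath]
    rfl
  have hsmul : ∀ (c : K) (p : Quiver.Path (G.sourcePt i) (G.sinkPt j))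
      (q : Quiver.Path (G.sourcePt k) (G.sinkPt l)),
      (c • ∑ s : Split (G.sourcePt i) (G.sinkPt j) with s.path = p,
        ∑ s' : Split (G.sourcePt k) (G.sinkPt l) with s'.path = q,
          splitMap (K := K) G.gluing s s'
            (G.edgeBracket K (G.gluing.map s.2.2.1) (G.gluing.map s'.2.2.1))) =
      ∑ s : Split (G.sourcePt i) (G.sinkPt j) with s.path = p,
        ∑ s' : Split (G.sourcePt k) (G.sinkPt l) with s'.path = q,
          c • splitMap (K := K) G.gluing s s'
            (G.edgeBracket K (G.gluing.map s.2.2.1) (G.gluing.map s'.2.2.1)) := by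
    intro c p q
    simp only [Finset.smul_sum]
  have hsplit : (G.doubleBracket K).br (G.marked i) (G.marked j) (G.marked k) (G.marked l)
        (G.boundaryMeasurement K x i j) (G.boundaryMeasurement K y k l) =
      ∑ s : Split (G.sourcePt i) (G.sinkPt j), ∑ s' : Split (G.sourcePt k) (G.sinkPt l),
        (x ^ G.pathIndex s.path * y ^ G.pathIndex s'.path) • splitMap (K := K) G.gluing s s'
          (G.edgeBracket K (G.gluing.map s.2.2.1) (G.gluing.map s'.2.2.1)) := by
    rw [boundaryMeasurement_eq, boundaryMeasurement_eq]
    rw [← sum_split_pair fun p q s s' => (x ^ G.pathIndex p * y ^ G.pathIndex q) •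
      splitMap (K := K) G.gluing s s'
          (G.edgeBracket K (G.gluing.map s.2.2.1) (G.gluing.map s'.2.2.1))]
    rw [LinearMap.map_sum₂]
    refine Finset.sum_congr rfl fun p _ => ?_
    rw [map_sum]
    refine Finset.sum_congr rfl fun q _ => ?_
    rw [map_smul, map_smul, LinearMap.smul_apply, smul_smul, mul_comm (y ^ _)]
    exact (congrArg (_ • ·) (hbr p q)).trans
      (hsmul _ p q)
  rw [hsplit]
  have hE : ∀ {a b c d : G.Torus} (e : a ⟶ b) (h : c ⟶ d), G.edgeBracket K e h =
      G.tailBracket K e h - G.headBracket K e h := fun e h => rfl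
  simp only [hE, map_sub, smul_sub, Finset.sum_sub_distrib]
  rw [G.sum_tailBracket hx hy, G.sum_headBracket hx hy, sub_neg_eq_add]
  simp only [← Finset.sum_add_distrib, ← add_smul, ← mul_add]
  refine (sum_split_pair fun p q s s' => (x ^ G.pathIndex p * y ^ G.pathIndex q *
    G.splitWeight (y / x) s s') • (ofPath K (G.gluing.mapPath p) ⊗ₜ[K]
      ofPath K (G.gluing.mapPath q))).symm.trans ?_
  have hB : ∀ z z' : K, G.boundaryMeasurement K z k j ⊗ₜ[K] G.boundaryMeasurement K z' i l =
      ∑ p : Quiver.Path (G.sourcePt k) (G.sinkPt j), ∑ q : Quiver.Path (G.sourcePt i) (G.sinkPt l),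
        (z ^ G.pathIndex p * z' ^ G.pathIndex q) •
          (ofPath K (G.gluePath p) ⊗ₜ[K] ofPath K (G.gluePath q)) := by
    intro z z'
    rw [boundaryMeasurement_eq, boundaryMeasurement_eq, TensorProduct.sum_tmul]
    refine Finset.sum_congr rfl fun p _ => ?_
    rw [TensorProduct.tmul_sum]
    refine Finset.sum_congr rfl fun q _ => ?_
    rw [TensorProduct.smul_tmul_smul]
  rw [hB, hB, Finset.smul_sum, Finset.smul_sum, ← Finset.sum_sub_distrib]
  refine Finset.sum_congr rfl fun p _ => ?_
  rw [Finset.smul_sum, Finset.smul_sum, ← Finset.sum_sub_distrib]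
  refine Finset.sum_congr rfl fun q _ => ?_
  simp only [← Finset.sum_smul, ← Finset.mul_sum, G.sum_splitWeight h2 hx hy hxy, smul_smul]
  rw [← sub_smul]
  change _ • (ofPath K (G.gluePath p) ⊗ₜ[K] ofPath K (G.gluePath q)) = _
  congr 1
  -- The factor (y/x)^(ind p − ind q) turns x^(ind p) y^(ind q) into y^(ind p) x^(ind q), so the
  -- spectral parameters are exchanged in the second term.
  rw [div_zpow, zpow_sub₀ hx, zpow_sub₀ hy]
  field_simp

end PerfectCylindricalNetwork

/-! ### Specialization to ℂ(λ, μ) -/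

theorem specLam_ne_zero : specLam ≠ 0 := by
  rw [specLam, Ne, FaithfulSMul.algebraMap_eq_zero_iff]
  exact MvPolynomial.X_ne_zero 0

theorem specMu_ne_zero : specMu ≠ 0 := by
  rw [specMu, Ne, FaithfulSMul.algebraMap_eq_zero_iff]
  exact MvPolynomial.X_ne_zero 1

theorem specLam_ne_specMu : specLam ≠ specMu := fun h => by
  have h1 := MvPolynomial.X_injective (IsFractionRing.injective (MvPolynomial (Fin 2) ℂ) _ h)
  exact absurd h1 (by decide)

/-- Supplies 2 ≠ 0, needed for the coefficients 1/2 at the corners. -/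
instance : CharZero SpectralField :=
  charZero_of_injective_algebraMap
    (IsFractionRing.injective (MvPolynomial (Fin 2) ℂ) SpectralField)

end NCNetwork

end

theorem mainTheorem3 {V E : Type*} [Fintype V] [Fintype E] {N : ℕ}
    (G : NCNetwork.PerfectCylindricalNetwork V E N N) (k : ℕ) (b₁ b₂ : Fin N) :
    G.hBracket NCNetwork.SpectralField b₁ b₂
        (NCNetwork.PMat.cyclicTrace
          (NCNetwork.PMat.pow
            (G.boundaryMeasurement NCNetwork.SpectralField NCNetwork.specLam) k))
        (G.boundaryMeasurement NCNetwork.SpectralField NCNetwork.specMu b₁ b₂) =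
      NCNetwork.PMat.mul (G.laxM NCNetwork.specLam NCNetwork.specMu k)
          (G.boundaryMeasurement NCNetwork.SpectralField NCNetwork.specMu) b₁ b₂ -
        NCNetwork.PMat.mul (G.boundaryMeasurement NCNetwork.SpectralField NCNetwork.specMu)
          (G.laxM NCNetwork.specLam NCNetwork.specMu k) b₁ b₂ := by
  -- The index `b₁` rules out the network without boundary points, for which there would be no first
  -- source to anchor the cut.
  have : NeZero N := ⟨b₁.pos.ne'⟩
  exact (G.doubleBracket NCNetwork.SpectralField).hBracket_trace_pow _ _ _
    (G.br_boundaryMeasurement two_ne_zero NCNetwork.specLam_ne_zero NCNetwork.specMu_ne_zero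
      NCNetwork.specLam_ne_specMu) k b₁ b₂
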